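/- Let $G=(V,E)$ be a finite simple graph and let $D=(E,A)$ be a digraph whose vertices are the edges of $G$. For $e\in E$ put $\mathrm{dep}(e)=\{e'\in E : (e',e)\in A\}$. Given $\ell,u:E\to\mathbb N$ and $w:E\to\mathbb R$, the problem G-DCMST$(G,D,\ell,u,w)$ asks for a spanning tree $T$ of $G$ with $\ell(e)\le |\mathrm{dep}(e)\cap E(T)|\le u(e)$ for every $e\in E(T)$ that minimizes $\sum_{e\in E(T)}w(e)$ among all such trees, or for the answer that no such tree exists. Theorem. There is an algorithm that solves G-DCMST$(G,D,0,u,w)$ in polynomial time on all instances $(G,D,0,u,w)$ in which $D=D_1\cup\dots\cup D_k$ is the union of $k$ disjoint (loopless) complete digraphs with $V(D_1)\cup\dots\cup V(D_k)=E$ and, for each $i\in\{1,\dots,k\}$, there exists $u_i\in\{1,\dots,|V(D_i)|\}$ such that $u(e)=u_i-1$ for every $e\in V(D_i)$. Here the algorithm is a single program for a random access machine whose cells hold natural or real numbers, with additions, subtractions, comparisons and memory accesses as its unit-cost operations and without real constants. The graph $G$ is given by the list of its edges, $D$ by the list of its arcs, and $\ell,u,w$ by the lists of their values, and the running time is at most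 $p(|V|+|E|+|A|)$ for a fixed polynomial $p$. The partition into $D_1,\dots,D_k$ and the numbers $u_i$ are not part of the input. -/

import Mathlib

/-! ### The problem -/

namespace GDC

/-- An instance `(G, D, ℓ, u, w)`: a simple graph `G`, a digraph `D` whose vertices are the edges of
`G`, lower and upper bounds `ℓ, u` and real weights `w` on the edges of `G`. -/
structure Inst (V : Type*) where
  G : SimpleGraph V
  D : Digraph G.edgeSet
  lo : G.edgeSet → ℕ
  up : G.edgeSet → ℕ
  w : G.edgeSet → ℝ

variable {V : Type*}

/-- The dependency set of `e`: all `e'` such that `(e', e)` is an arc of `D`. -/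
def Inst.dep (I : Inst V) (e : I.G.edgeSet) : Set I.G.edgeSet :=
  {e' | I.D.Adj e' e}

/-- The edges of `G` that belong to `H`, as a set of vertices of `D`. -/
def Inst.edgesOf (I : Inst V) (H : SimpleGraph V) : Set I.G.edgeSet :=
  {e | (e : Sym2 V) ∈ H.edgeSet}

/-- `H` `(ℓ, u)`-satisfies `D`. -/
def Inst.Satisfies (I : Inst V) (H : SimpleGraph V) : Prop :=
  ∀ e ∈ I.edgesOf H,
    I.lo e ≤ (I.dep e ∩ I.edgesOf H).ncard ∧ (I.dep e ∩ I.edgesOf H).ncard ≤ I.up e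

/-- `T` is a spanning tree of `G` that `(ℓ, u)`-satisfies `D`. -/
def Inst.IsFeasible (I : Inst V) (T : SimpleGraph V) : Prop :=
  T ≤ I.G ∧ T.IsTree ∧ I.Satisfies T

/-- The weight sum of the edges of `T`. -/
noncomputable def Inst.weight (I : Inst V) (T : SimpleGraph V) : ℝ :=
  ∑ᶠ e ∈ I.edgesOf T, I.w e

/-- `T` is an optimal solution: a feasible spanning tree of minimum weight sum. -/
def Inst.IsOptimal (I : Inst V) (T : SimpleGraph V) : Prop :=
  I.IsFeasible T ∧ ∀ T', I.IsFeasible T' → I.weight T ≤ I.weight T'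

/-- `D` is the union of the (loopless) complete digraphs with the pairwise disjoint vertex sets
`C 0, …, C (k - 1)`, which together exhaust the vertices of `D`. -/
structure IsDisjointUnionOfComplete {E : Type*} (D : Digraph E) {k : ℕ} (C : Fin k → Set E) :
    Prop where
  disjoint : ∀ i j, i ≠ j → Disjoint (C i) (C j)
  cover : ⋃ i, C i = Set.univ
  adj_iff : ∀ e f, D.Adj e f ↔ e ≠ f ∧ ∃ i, e ∈ C i ∧ f ∈ C i

end GDC

/-! ### The machine model

A random access machine with two kinds of cells, holding natural numbers and real numbers. Cells
are organised in arrays; the name of an array is a literal of the program, an index is computed.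
The only arithmetic is addition and subtraction, the only tests are comparisons, and there are no
real literals and no conversions between the two kinds. Every elementary operation costs one. -/

namespace RealRAM

/-- The memory: `nat a i` and `real a i` are the cells with index `i` of the arrays named `a`. -/
structure Mem where
  nat : ℕ → ℕ → ℕ
  real : ℕ → ℕ → ℝ

/-- Expressions with a natural number as value. -/
inductive NatExpr where
  | lit (c : ℕ)
  | get (a : ℕ) (i : NatExpr)
  | add (x y : NatExpr)
  | sub (x y : NatExpr)

/-- The value; subtraction is truncated at `0`. -/
def NatExpr.eval (s : Mem) : NatExpr → ℕ
  | lit c => c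
  | get a i => s.nat a (i.eval s)
  | add x y => x.eval s + y.eval s
  | sub x y => x.eval s - y.eval s

/-- The number of elementary operations in an evaluation. -/
def NatExpr.cost : NatExpr → ℕ
  | lit _ => 1
  | get _ i => i.cost + 1
  | add x y => x.cost + y.cost + 1
  | sub x y => x.cost + y.cost + 1

/-- Expressions with a real number as value. -/
inductive RealExpr where
  | get (a : ℕ) (i : NatExpr)
  | add (x y : RealExpr)
  | sub (x y : RealExpr)

noncomputable def RealExpr.eval (s : Mem) : RealExpr → ℝ
  | get a i => s.real a (i.eval s)
  | add x y => x.eval s + y.eval s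
  | sub x y => x.eval s - y.eval s

/-- The number of elementary operations in an evaluation. -/
def RealExpr.cost : RealExpr → ℕ
  | get _ i => i.cost + 1
  | add x y => x.cost + y.cost + 1
  | sub x y => x.cost + y.cost + 1

/-- Tests. -/
inductive Cond where
  | natLe (x y : NatExpr)
  | realLe (x y : RealExpr)
  | not (c : Cond)
  | and (c d : Cond)

def Cond.Holds (s : Mem) : Cond → Prop
  | natLe x y => x.eval s ≤ y.eval s
  | realLe x y => x.eval s ≤ y.eval s
  | not c => ¬ c.Holds s
  | and c d => c.Holds s ∧ d.Holds s

/-- The number of elementary operations in an evaluation. -/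
def Cond.cost : Cond → ℕ
  | natLe x y => x.cost + y.cost + 1
  | realLe x y => x.cost + y.cost + 1
  | not c => c.cost + 1
  | and c d => c.cost + d.cost + 1

/-- Programs. `setNat a i x` and `setReal a i x` write the value of `x` into the cell with index
`i` of the array `a`; `loop c p` runs `p` as long as `c` holds. -/
inductive Program where
  | skip
  | setNat (a : ℕ) (i x : NatExpr)
  | setReal (a : ℕ) (i : NatExpr) (x : RealExpr)
  | seq (p q : Program)
  | branch (c : Cond) (p q : Program)
  | loop (c : Cond) (p : Program)

def Mem.writeNat (s : Mem) (a i x : ℕ) : Mem :=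
  { s with nat := Function.update s.nat a (Function.update (s.nat a) i x) }

noncomputable def Mem.writeReal (s : Mem) (a i : ℕ) (x : ℝ) : Mem :=
  { s with real := Function.update s.real a (Function.update (s.real a) i x) }

/-- `Runs p s t s'`: started in memory `s`, the program `p` halts after exactly `t` steps, in
memory `s'`. -/
inductive Runs : Program → Mem → ℕ → Mem → Prop where
  | skip (s : Mem) : Runs .skip s 1 s
  | setNat (a : ℕ) (i x : NatExpr) (s : Mem) :
      Runs (.setNat a i x) s (i.cost + x.cost + 1) (s.writeNat a (i.eval s) (x.eval s))
  | setReal (a : ℕ) (i : NatExpr) (x : RealExpr) (s : Mem) :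
      Runs (.setReal a i x) s (i.cost + x.cost + 1) (s.writeReal a (i.eval s) (x.eval s))
  | seq {p q : Program} {s s₁ s₂ : Mem} {t₁ t₂ : ℕ} :
      Runs p s t₁ s₁ → Runs q s₁ t₂ s₂ → Runs (.seq p q) s (t₁ + t₂) s₂
  | branchTrue {c : Cond} {p q : Program} {s s₁ : Mem} {t : ℕ} :
      c.Holds s → Runs p s t s₁ → Runs (.branch c p q) s (c.cost + 1 + t) s₁
  | branchFalse {c : Cond} {p q : Program} {s s₁ : Mem} {t : ℕ} :
      ¬ c.Holds s → Runs q s t s₁ → Runs (.branch c p q) s (c.cost + 1 + t) s₁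
  | loopTrue {c : Cond} {p : Program} {s s₁ s₂ : Mem} {t₁ t₂ : ℕ} :
      c.Holds s → Runs p s t₁ s₁ → Runs (.loop c p) s₁ t₂ s₂ →
        Runs (.loop c p) s (c.cost + 1 + t₁ + t₂) s₂
  | loopFalse {c : Cond} {p : Program} {s : Mem} :
      ¬ c.Holds s → Runs (.loop c p) s (c.cost + 1) s

end RealRAM

/-! ### Instances as inputs of the machine -/

namespace GDC

open RealRAM

variable {V : Type*}

/-- A description of an instance: the vertices, the edges of `G` and the arcs of `D` are listed
without repetition, in an arbitrary order; an edge is given by its two ends, in either order, and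
an arc by its tail and its head. -/
structure Listing (I : Inst V) where
  n : ℕ
  m : ℕ
  a : ℕ
  vertex : Fin n ≃ V
  edge : Fin m ≃ I.G.edgeSet
  end₁ : Fin m → Fin n
  end₂ : Fin m → Fin n
  edge_eq : ∀ j, (edge j : Sym2 V) = s(vertex (end₁ j), vertex (end₂ j))
  tail : Fin a → Fin m
  head : Fin a → Fin m
  arc_iff : ∀ e f, I.D.Adj e f ↔ ∃ r, edge (tail r) = e ∧ edge (head r) = f
  arc_injective : ∀ r r', tail r = tail r' → head r = head r' → r = r'

/-- The size of the input: the number of vertices, edges and arcs. -/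
def Listing.size {I : Inst V} (L : Listing I) : ℕ :=
  L.n + L.m + L.a

/-- The finite list `f 0, …, f (k - 1)` as the content of an array, with zeros behind it. -/
def array {α : Type*} [Zero α] {k : ℕ} (f : Fin k → α) : ℕ → α :=
  fun i => if h : i < k then f ⟨i, h⟩ else 0

/-- The initial memory. The arrays of natural numbers hold `n, m, a` (array 0), the two ends of
each edge (1 and 2), the tail and the head of each arc (3 and 4), and the bounds `ℓ` and `u` of
each edge (5 and 6); the array 0 of real numbers holds the weights. All other cells are zero. -/
def Listing.input {I : Inst V} (L : Listing I) : Mem where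
  nat
    | 0 => array ![L.n, L.m, L.a]
    | 1 => array fun j => (L.end₁ j : ℕ)
    | 2 => array fun j => (L.end₂ j : ℕ)
    | 3 => array fun r => (L.tail r : ℕ)
    | 4 => array fun r => (L.head r : ℕ)
    | 5 => array fun j => I.lo (L.edge j)
    | 6 => array fun j => I.up (L.edge j)
    | _ => fun _ => 0
  real
    | 0 => array fun j => I.w (L.edge j)
    | _ => fun _ => 0

/-- The answer read from the final memory is correct: either cell 0 of array 7 is 1 and the edges
marked by 1 in array 8 are exactly the edges of an optimal solution, or cell 0 of array 7 is 0 and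
there is no feasible spanning tree. -/
def Listing.CorrectOutput {I : Inst V} (L : Listing I) (s : Mem) : Prop :=
  (s.nat 7 0 = 1 ∧ ∃ T, I.IsOptimal T ∧ ∀ j : Fin L.m, s.nat 8 j = 1 ↔ L.edge j ∈ I.edgesOf T) ∨
    (s.nat 7 0 = 0 ∧ ∀ T, ¬ I.IsFeasible T)

/-- On every description of the instance `I`, the program `P` halts with a correct output, after at
most `p(N)` steps, where `N` is the size of the input. -/
def SolvesWithin (P : Program) (p : Polynomial ℕ) (I : Inst V) : Prop :=
  ∀ L : Listing I, ∃ t s, Runs P L.input t s ∧ t ≤ p.eval L.size ∧ L.CorrectOutput s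

end GDC

/-!
If `D` is a disjoint union of complete digraphs, then the edges of a component `Dᵢ`, said to have
colour `i`, satisfy the constraints if and only if a tree has at most `uᵢ` of them. Hence the
problem asks for a spanning tree of minimum weight that is independent in a partition matroid.

It is solved by a primal-dual method. A penalty `λᵢ ≥ 0` is added to the weights of the edges of
colour `i`, and a spanning tree `T` of minimum penalized weight is maintained such that `λᵢ ≠ 0`
only if `T` has at least `uᵢ` edges of colour `i`; initially `λ = 0`. By complementary slackness,
such a tree is optimal as soon as no colour exceeds its bound.

If `T` exceeds a bound, the colours from which a colour that is not used up can be reached by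
exchanges of edges of equal penalized weight are collected. If an exchange leads from another colour
into this set, then raising the penalties of all other colours by the smallest gap of such an
exchange preserves the invariant and reaches a further colour. If there is no such exchange, then
`T` has as many edges as possible whose colours have not been reached, so that a colour among them
that exceeds its bound shows that there is no feasible tree. If a colour that exceeds its bound has
been reached, then the exchanges along a path of colours are performed. As every exchange on it is
one to the colour reached earliest, no exchange on the path spoils a later one, and the excess of
`T` over the bounds decreases by one. There are at most `|V|` such augmentations and at most `|E|`
rounds in each search.
-/

namespace GDC

/-! ### Connectivity and spanning trees -/

section Linked

variable {ι V : Type*}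

/-- Connectivity in the multigraph with the edges `x j — y j` for `j ∈ S`. -/
def Linked (x y : ι → V) (S : Finset ι) : V → V → Prop :=
  Relation.EqvGen fun u v => ∃ j ∈ S, u = x j ∧ v = y j

namespace Linked

variable {x y : ι → V} {S S' : Finset ι} {u v p : V} {i j : ι}

theorem equivalence (x y : ι → V) (S : Finset ι) : Equivalence (Linked x y S) :=
  Relation.EqvGen.is_equivalence _

theorem refl (u : V) : Linked x y S u u := (equivalence x y S).refl u

theorem symm (h : Linked x y S u v) : Linked x y S v u := (equivalence x y S).symm h

theorem trans (h : Linked x y S u v) (h' : Linked x y S v p) : Linked x y S u p :=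
  (equivalence x y S).trans h h'

theorem of_mem (h : j ∈ S) : Linked x y S (x j) (y j) := .rel _ _ ⟨j, h, rfl, rfl⟩

theorem rec_equivalence {r : V → V → Prop} (hr : Equivalence r) (h : ∀ j ∈ S, r (x j) (y j))
    (huv : Linked x y S u v) : r u v := by
  refine hr.eqvGen_iff.1 (huv.mono ?_)
  rintro _ _ ⟨j, hj, rfl, rfl⟩
  exact h j hj

theorem of_forall_mem (h : ∀ j ∈ S, Linked x y S' (x j) (y j)) (huv : Linked x y S u v) :
    Linked x y S' u v :=
  huv.rec_equivalence (equivalence x y S') h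

theorem mono (h : S ⊆ S') (huv : Linked x y S u v) : Linked x y S' u v :=
  huv.of_forall_mem fun _ hj => of_mem (h hj)

theorem empty_iff : Linked x y ∅ u v ↔ u = v :=
  ⟨rec_equivalence eq_equivalence (by simp), fun h => h ▸ refl u⟩

theorem exists_mem_not_linked (h : Linked x y S u v) (h' : ¬ Linked x y S' u v) :
    ∃ j ∈ S, ¬ Linked x y S' (x j) (y j) := by
  contrapose! h'
  exact h.of_forall_mem h'

theorem insert_iff [DecidableEq ι] : Linked x y (insert j S) u v ↔ Linked x y S u v ∨
    (Linked x y S u (x j) ∧ Linked x y S (y j) v) ∨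
    (Linked x y S u (y j) ∧ Linked x y S (x j) v) := by
  constructor
  · refine rec_equivalence (r := fun u v => Linked x y S u v ∨
      (Linked x y S u (x j) ∧ Linked x y S (y j) v) ∨
      (Linked x y S u (y j) ∧ Linked x y S (x j) v)) ⟨fun u => .inl (refl u), ?_, ?_⟩ ?_
    · rintro u v (h | ⟨h, h'⟩ | ⟨h, h'⟩)
      exacts [.inl h.symm, .inr (.inr ⟨h'.symm, h.symm⟩), .inr (.inl ⟨h'.symm, h.symm⟩)]
    · rintro u v p (h | ⟨h, h'⟩ | ⟨h, h'⟩) (k | ⟨k, k'⟩ | ⟨k, k'⟩)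
      exacts [.inl (h.trans k), .inr (.inl ⟨h.trans k, k'⟩), .inr (.inr ⟨h.trans k, k'⟩),
        .inr (.inl ⟨h, h'.trans k⟩), .inr (.inl ⟨h, k'⟩), .inl (h.trans k'),
        .inr (.inr ⟨h, h'.trans k⟩), .inl (h.trans k'), .inr (.inr ⟨h, k'⟩)]
    · refine Finset.forall_mem_insert _ _ _ |>.2 ⟨.inr (.inl ⟨refl _, refl _⟩), fun i hi => ?_⟩
      exact .inl (of_mem hi)
  · have hsub : S ⊆ insert j S := Finset.subset_insert j S
    have hj : Linked x y (insert j S) (x j) (y j) := of_mem (Finset.mem_insert_self j S)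
    rintro (h | ⟨h, h'⟩ | ⟨h, h'⟩)
    exacts [h.mono hsub, (h.mono hsub).trans (hj.trans (h'.mono hsub)),
      (h.mono hsub).trans (hj.symm.trans (h'.mono hsub))]

theorem exists_pairwise_not_linked (x y : ι → V) (W : Finset V) (S : Finset ι) :
    ∃ R ⊆ W, (∀ u ∈ R, ∀ v ∈ R, Linked x y S u v → u = v) ∧ W.card ≤ R.card + S.card := by
  classical
  induction S using Finset.induction_on with
  | empty => exact ⟨W, subset_rfl, fun u _ v _ h => empty_iff.1 h, by simp⟩
  | insert j S hj ih =>
    obtain ⟨R, hRW, hR, hcard⟩ := ih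
    refine ⟨{u ∈ R | ¬ Linked x y S u (y j)}, (Finset.filter_subset _ _).trans hRW, ?_, ?_⟩
    · intro u hu v hv h
      rw [Finset.mem_filter] at hu hv
      rcases insert_iff.1 h with h | ⟨-, h⟩ | ⟨h, -⟩
      exacts [hR u hu.1 v hv.1 h, absurd h.symm hv.2, absurd h hu.2]
    · have hlost : {u ∈ R | Linked x y S u (y j)}.card ≤ 1 := by
        refine Finset.card_le_one.2 fun u hu v hv => ?_
        rw [Finset.mem_filter] at hu hv
        exact hR u hu.1 v hv.1 (hu.2.trans hv.2.symm)
      have := Finset.card_filter_add_card_filter_not (s := R) fun u => Linked x y S u (y j)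
      rw [Finset.card_insert_of_notMem hj]
      lia

theorem card_le_card_add_one {W : Finset V} (h : ∀ u ∈ W, ∀ v ∈ W, Linked x y S u v) :
    W.card ≤ S.card + 1 := by
  obtain ⟨R, hRW, hR, hcard⟩ := exists_pairwise_not_linked x y W S
  have : R.card ≤ 1 := Finset.card_le_one.2 fun u hu v hv =>
    hR u hu v hv (h u (hRW hu) v (hRW hv))
  lia

theorem exists_minimal_subset [DecidableEq ι] (h : Linked x y S u v) :
    ∃ C ⊆ S, Linked x y C u v ∧ ∀ j ∈ C, ¬ Linked x y (C.erase j) u v := by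
  obtain ⟨C, hCS, hC⟩ := exists_minimal_le_of_wellFoundedLT (Linked x y · u v) S h
  exact ⟨C, hCS, hC.prop, fun j hj => hC.not_prop_of_lt (Finset.erase_ssubset hj)⟩

theorem insert_erase_of_not_erase [DecidableEq ι] (h : Linked x y S (x i) (y i)) (hj : j ∈ S)
    (h' : ¬ Linked x y (S.erase j) (x i) (y i)) :
    Linked x y (insert i (S.erase j)) (x j) (y j) := by
  rw [← Finset.insert_erase hj, insert_iff] at h
  rw [insert_iff]
  rcases h with h | ⟨h, k⟩ | ⟨h, k⟩
  exacts [absurd h h', .inr (.inl ⟨h.symm, k.symm⟩), .inr (.inr ⟨k, h⟩)]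

end Linked

/-- The edges `x j — y j` with `j ∈ S` form a spanning tree of the multigraph with vertex set `W`
and edges indexed by `E`. Acyclicity is encoded by the number of edges. -/
structure IsSpanningTree (W : Finset V) (E : Finset ι) (x y : ι → V) (S : Finset ι) : Prop where
  subset : S ⊆ E
  card_add_one : S.card + 1 = W.card
  linked : ∀ u ∈ W, ∀ v ∈ W, Linked x y S u v

namespace IsSpanningTree

variable {W : Finset V} {E B S : Finset ι} {x y : ι → V} {i j : ι}

theorem of_linked (hS : S ⊆ E) (hcard : S.card + 1 ≤ W.card)
    (h : ∀ u ∈ W, ∀ v ∈ W, Linked x y S u v) : IsSpanningTree W E x y S :=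
  ⟨hS, hcard.antisymm (Linked.card_le_card_add_one h), h⟩

theorem exists_not_linked_of_card_lt (hB : IsSpanningTree W E x y B) (h : S.card < B.card) :
    ∃ j ∈ B, ¬ Linked x y S (x j) (y j) := by
  by_contra! hc
  have := Linked.card_le_card_add_one fun u hu v hv => (hB.linked u hu v hv).of_forall_mem hc
  have := hB.card_add_one
  lia

variable [DecidableEq ι]

theorem not_linked_erase (hB : IsSpanningTree W E x y B) (hj : j ∈ B) :
    ¬ Linked x y (B.erase j) (x j) (y j) := by
  obtain ⟨i, hi, h⟩ := hB.exists_not_linked_of_card_lt (Finset.card_erase_lt_of_mem hj)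
  obtain rfl : i = j := by
    by_contra hij
    exact h (.of_mem (Finset.mem_erase.2 ⟨hij, hi⟩))
  exact h

theorem insert_erase_of_linked (hB : IsSpanningTree W E x y B) (hj : j ∈ B) (hi : i ∈ E)
    (hiB : i ∉ B.erase j) (h : Linked x y (insert i (B.erase j)) (x j) (y j)) :
    IsSpanningTree W E x y (insert i (B.erase j)) where
  subset := Finset.insert_subset hi ((Finset.erase_subset j B).trans hB.subset)
  card_add_one := by
    rw [Finset.card_insert_of_notMem hiB, Finset.card_erase_add_one hj, hB.card_add_one]
  linked u hu v hv := by
    refine (hB.linked u hu v hv).of_forall_mem fun k hk => ?_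
    by_cases hkj : k = j
    · exact hkj ▸ h
    · exact .of_mem (Finset.mem_insert_of_mem (Finset.mem_erase.2 ⟨hkj, hk⟩))

theorem insert_erase_of_not_linked (hB : IsSpanningTree W E x y B) (hj : j ∈ B) (hi : i ∈ E)
    (hx : x i ∈ W) (hy : y i ∈ W) (h : ¬ Linked x y (B.erase j) (x i) (y i)) :
    IsSpanningTree W E x y (insert i (B.erase j)) :=
  hB.insert_erase_of_linked hj hi (fun hiB => h (.of_mem hiB))
    ((hB.linked _ hx _ hy).insert_erase_of_not_erase hj h)

theorem not_linked_of_insert_erase (hB : IsSpanningTree W E x y B) (hj : j ∈ B)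
    (h : IsSpanningTree W E x y (insert i (B.erase j))) :
    ¬ Linked x y (B.erase j) (x i) (y i) := by
  intro hc
  obtain ⟨k, hk, hkc⟩ := h.exists_not_linked_of_card_lt (S := B.erase j) (by
    have := h.card_add_one
    have := hB.card_add_one
    have := Finset.card_erase_add_one hj
    lia)
  rcases Finset.mem_insert.1 hk with rfl | hk
  exacts [hkc hc, hkc (.of_mem hk)]

theorem exists_cycle (hB : IsSpanningTree W E x y B) (hi : i ∈ E) (hiB : i ∉ B) (hx : x i ∈ W)
    (hy : y i ∈ W) : ∃ C ⊆ B, Linked x y C (x i) (y i) ∧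
      ∀ j ∈ C, IsSpanningTree W E x y (insert i (B.erase j)) := by
  obtain ⟨C, hCB, hC, hmin⟩ := (hB.linked _ hx _ hy).exists_minimal_subset
  refine ⟨C, hCB, hC, fun j hj => ?_⟩
  refine hB.insert_erase_of_linked (hCB hj) hi (fun h => hiB (Finset.mem_of_mem_erase h)) ?_
  exact (hC.insert_erase_of_not_erase hj (hmin j hj)).mono
    (Finset.insert_subset_insert _ (Finset.erase_subset_erase _ hCB))

end IsSpanningTree

end Linked

/-! ### Symmetric exchange -/

section SymmExchange

variable {ι : Type*}

/-- `A` is a member of the family `F` of minimum weight. -/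
def MinWeight (F : Finset ι → Prop) (w : ι → ℝ) (A : Finset ι) : Prop :=
  F A ∧ ∀ B, F B → ∑ j ∈ A, w j ≤ ∑ j ∈ B, w j

theorem exists_minWeight {F : Finset ι → Prop} {A E : Finset ι} (hE : ∀ A, F A → A ⊆ E)
    (hA : F A) (w : ι → ℝ) :
    ∃ B, MinWeight F w B := by
  classical
  obtain ⟨B, hB, hmin⟩ := Finset.exists_min_image {A ∈ E.powerset | F A} (fun A => ∑ j ∈ A, w j)
    ⟨A, by simpa using ⟨hE A hA, hA⟩⟩
  rw [Finset.mem_filter] at hB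
  exact ⟨B, hB.2, fun D hD => hmin D (by simpa using ⟨hE D hD, hD⟩)⟩

variable [DecidableEq ι]

/-- The symmetric exchange property of the family of bases of a matroid. -/
def SymmExchange (F : Finset ι → Prop) : Prop :=
  ∀ A B, F A → F B → ∀ i ∈ B, i ∉ A →
    ∃ j ∈ A, j ∉ B ∧ F (insert i (A.erase j)) ∧ F (insert j (B.erase i))

theorem IsSpanningTree.symmExchange {V : Type*} {W : Finset V} {E : Finset ι} {x y : ι → V}
    (hx : ∀ j ∈ E, x j ∈ W) (hy : ∀ j ∈ E, y j ∈ W) : SymmExchange (IsSpanningTree W E x y) := by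
  intro A B hA hB i hi hiA
  have hiE := hB.subset hi
  obtain ⟨C, hCA, hC, hcycle⟩ := hA.exists_cycle hiE hiA (hx i hiE) (hy i hiE)
  obtain ⟨j, hj, hcut⟩ := hC.exists_mem_not_linked (hB.not_linked_erase hi)
  have hjE := hA.subset (hCA hj)
  have hji : j ≠ i := fun h => hiA (h ▸ hCA hj)
  exact ⟨j, hCA hj, fun hjB => hcut (.of_mem (Finset.mem_erase.2 ⟨hji, hjB⟩)), hcycle j hj,
    hB.insert_erase_of_not_linked hi hjE (hx j hjE) (hy j hjE) hcut⟩

variable {F : Finset ι → Prop} {w : ι → ℝ} {A B : Finset ι} {i j k l : ι}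

theorem sum_insert_erase (w : ι → ℝ) (hj : j ∈ A) (hi : i ∉ A) :
    ∑ k ∈ insert i (A.erase j), w k = ∑ k ∈ A, w k + w i - w j := by
  rw [Finset.sum_insert fun h => hi (Finset.mem_of_mem_erase h), ← Finset.add_sum_erase A w hj]
  ring

theorem MinWeight.insert_erase_iff (h : MinWeight F w A) (hj : j ∈ A) (hi : i ∉ A) :
    MinWeight F w (insert i (A.erase j)) ↔ F (insert i (A.erase j)) ∧ w i = w j := by
  have hsum := sum_insert_erase w hj hi
  constructor
  · intro h'
    have := h'.2 A h.1
    have := h.2 _ h'.1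
    exact ⟨h'.1, by linarith⟩
  · rintro ⟨hF, hw⟩
    refine ⟨hF, fun B hB => ?_⟩
    have := h.2 B hB
    linarith

theorem MinWeight.le_of_insert_erase (h : MinWeight F w A) (hj : j ∈ A) (hi : i ∉ A)
    (hF : F (insert i (A.erase j))) : w j ≤ w i := by
  have := h.2 _ hF
  rw [sum_insert_erase w hj hi] at this
  linarith

/-- The step of Kruskal's algorithm. -/
theorem MinWeight.exists_insert_subset {V : Type*} {W : Finset V} {E S T : Finset ι}
    {x y : ι → V} (hS : MinWeight (IsSpanningTree W E x y) w S) (hTS : T ⊆ S) (hi : i ∈ E)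
    (hx : x i ∈ W) (hy : y i ∈ W) (hiT : ¬ Linked x y T (x i) (y i))
    (hmin : ∀ j ∈ E, ¬ Linked x y T (x j) (y j) → w i ≤ w j) :
    ∃ S', MinWeight (IsSpanningTree W E x y) w S' ∧ insert i T ⊆ S' := by
  by_cases hiS : i ∈ S
  · exact ⟨S, hS, Finset.insert_subset hiS hTS⟩
  obtain ⟨C, hCS, hC, hcycle⟩ := hS.1.exists_cycle hi hiS hx hy
  obtain ⟨j, hj, hjT⟩ := hC.exists_mem_not_linked hiT
  have hTj : T ⊆ S.erase j := fun k hk => Finset.mem_erase.2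
    ⟨fun hkj => hjT (hkj ▸ .of_mem hk), hTS hk⟩
  have hle := hmin j (hS.1.subset (hCS hj)) hjT
  have hge := hS.le_of_insert_erase (hCS hj) hiS (hcycle j hj)
  exact ⟨_, (hS.insert_erase_iff (hCS hj) hiS).2 ⟨hcycle j hj, hle.antisymm hge⟩,
    Finset.insert_subset_insert i hTj⟩

namespace SymmExchange

theorem eq_of_subset (hF : SymmExchange F) (hA : F A) (hB : F B) (h : A ⊆ B) : A = B := by
  by_contra hne
  obtain ⟨i, hi, hiA⟩ := Finset.exists_of_ssubset (h.ssubset_of_ne hne)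
  obtain ⟨j, hj, hjB, -⟩ := hF A B hA hB i hi hiA
  exact hjB (h hj)

theorem minWeight (hF : SymmExchange F) (w : ι → ℝ) : SymmExchange (MinWeight F w) := by
  intro A B hA hB i hi hiA
  obtain ⟨j, hj, hjB, hA', hB'⟩ := hF A B hA.1 hB.1 i hi hiA
  have hw : w i = w j :=
    (hB.le_of_insert_erase hi hjB hB').antisymm (hA.le_of_insert_erase hj hiA hA')
  exact ⟨j, hj, hjB, (hA.insert_erase_iff hj hiA).2 ⟨hA', hw⟩,
    (hB.insert_erase_iff hi hjB).2 ⟨hB', hw.symm⟩⟩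

theorem minWeight_of_forall_insert_erase (hF : SymmExchange F) (hA : F A)
    (h : ∀ j ∈ A, ∀ i ∉ A, F (insert i (A.erase j)) → w j ≤ w i) : MinWeight F w A := by
  refine ⟨hA, fun B hB => ?_⟩
  induction hs : (B \ A).card generalizing B with
  | zero =>
    rw [Finset.card_eq_zero, Finset.sdiff_eq_empty_iff_subset] at hs
    rw [hF.eq_of_subset hB hA hs]
  | succ s ih =>
    obtain ⟨i, hi⟩ : (B \ A).Nonempty := Finset.card_pos.1 (by lia)
    rw [Finset.mem_sdiff] at hi
    obtain ⟨j, hj, hjB, hA', hB'⟩ := hF A B hA hB i hi.1 hi.2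
    have hcloser : (insert j (B.erase i) \ A).card = s := by
      rw [Finset.insert_sdiff_of_mem _ hj, Finset.erase_sdiff_comm,
        Finset.card_erase_of_mem (Finset.mem_sdiff.2 hi), hs, Nat.add_sub_cancel]
    have := ih _ hB' hcloser
    have := sum_insert_erase w hi.1 hjB
    have := h j hj i hi.2 hA'
    linarith

theorem insert_erase_insert_erase (hF : SymmExchange F) (hi : i ∉ A) (hj : j ∈ A) (hk : k ∉ A)
    (hl : l ∈ A) (hik : i ≠ k) (hjl : j ≠ l) (hij : F (insert i (A.erase j)))
    (hkj : ¬ F (insert k (A.erase j))) (hkl : F (insert k (A.erase l))) :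
    F (insert k ((insert i (A.erase j)).erase l)) := by
  obtain ⟨p, hp, hp', -, h⟩ := hF _ _ hij hkl j (by grind) (by grind)
  obtain rfl | rfl : p = i ∨ p = l := by grind
  · convert h using 1
    grind
  · refine absurd ?_ hkj
    convert h using 1
    grind

theorem not_insert_erase_insert_erase (hF : SymmExchange F) (hA : F A) (hk : k ∉ A)
    (hkj : ¬ F (insert k (A.erase j))) (hkl : ¬ F (insert k (A.erase l))) :
    ¬ F (insert k ((insert i (A.erase j)).erase l)) := by
  intro hB
  obtain ⟨p, hp, hp', h, -⟩ := hF _ _ hA hB k (Finset.mem_insert_self _ _) hk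
  obtain rfl | rfl : p = j ∨ p = l := by grind
  exacts [hkj h, hkl h]

end SymmExchange

end SymmExchange

/-! ### Bases with bounds on the number of elements of each colour -/

/-- The bases of a matroid on a set of weighted and coloured elements, together with a bound `cap c`
on the number of elements of colour `c`. -/
structure ColoredBases (ι κ : Type*) [DecidableEq ι] where
  ground : Finset ι
  palette : Finset κ
  IsBase : Finset ι → Prop
  color : ι → κ
  cap : κ → ℕ
  weight : ι → ℝ
  subset_ground : ∀ {S}, IsBase S → S ⊆ ground
  symmExchange : SymmExchange IsBase
  color_mem : ∀ {j}, j ∈ ground → color j ∈ palette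

namespace ColoredBases

variable {ι κ : Type*} [DecidableEq ι] (B : ColoredBases ι κ)

/-- The weight of an element increased by the penalty for its colour. -/
def penalized (lam : κ → ℝ) (j : ι) : ℝ := B.weight j + lam (B.color j)

/-- `S` is a base of minimum penalized weight. -/
def IsMinBase (lam : κ → ℝ) (S : Finset ι) : Prop := MinWeight B.IsBase (B.penalized lam) S

/-- The removal of `e` from `T` and the insertion of `f` yield a base. -/
structure Exchangeable (T : Finset ι) (e f : ι) : Prop where
  mem : e ∈ T
  isBase : B.IsBase (insert f (T.erase e))

variable {B} {lam lam' : κ → ℝ} {S T T' : Finset ι} {e f j : ι} {c : κ}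

theorem Exchangeable.mem_ground (h : B.Exchangeable T e f) : f ∈ B.ground :=
  B.subset_ground h.isBase (Finset.mem_insert_self _ _)

theorem Exchangeable.notMem (h : B.Exchangeable T e f) (hT : B.IsBase T) (hne : e ≠ f) :
    f ∉ T := by
  intro hf
  have hsub : insert f (T.erase e) ⊆ T := Finset.insert_subset hf (Finset.erase_subset _ _)
  have he := h.mem
  rw [← B.symmExchange.eq_of_subset h.isBase hT hsub] at he
  simp [hne] at he

theorem isMinBase_of_forall_exchangeable (hT : B.IsBase T)
    (h : ∀ e f, B.Exchangeable T e f → B.penalized lam e ≤ B.penalized lam f) :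
    B.IsMinBase lam T :=
  B.symmExchange.minWeight_of_forall_insert_erase hT fun e he f _ hef => h e f ⟨he, hef⟩

namespace IsMinBase

theorem exchange_iff (h : B.IsMinBase lam T) (he : e ∈ T) (hf : f ∉ T) :
    B.IsMinBase lam (insert f (T.erase e)) ↔
      B.Exchangeable T e f ∧ B.penalized lam f = B.penalized lam e := by
  rw [IsMinBase, MinWeight.insert_erase_iff h he hf]
  exact and_congr_left fun _ => ⟨fun hB => ⟨he, hB⟩, fun hB => hB.isBase⟩

theorem penalized_le (h : B.IsMinBase lam T) (hef : B.Exchangeable T e f) :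
    B.penalized lam e ≤ B.penalized lam f := by
  by_cases hne : e = f
  · rw [hne]
  · exact MinWeight.le_of_insert_erase h hef.mem (hef.notMem h.1 hne) hef.isBase

end IsMinBase

section Bounds

variable [DecidableEq κ]

variable (B) in
/-- The number of elements of colour `c` of `S`. -/
def count (c : κ) (S : Finset ι) : ℕ := {j ∈ S | B.color j = c}.card

variable (B) in
/-- `S` is a base within the bounds. -/
def IsFeasible (S : Finset ι) : Prop := B.IsBase S ∧ ∀ c ∈ B.palette, B.count c S ≤ B.cap c

variable (B) in
/-- The number of elements of `S` beyond the bounds. -/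
def excess (S : Finset ι) : ℕ := ∑ c ∈ B.palette, (B.count c S - B.cap c)

variable (B) in
/-- The penalties `lam` are dual feasible for the bounds and satisfy complementary slackness with
the base `S`, except that `S` may exceed the bounds. -/
structure IsDual (lam : κ → ℝ) (S : Finset ι) : Prop where
  isMinBase : B.IsMinBase lam S
  nonneg : ∀ c ∈ B.palette, 0 ≤ lam c
  slack : ∀ c ∈ B.palette, lam c ≠ 0 → B.cap c ≤ B.count c S

theorem excess_eq_zero_iff : B.excess T = 0 ↔ ∀ c ∈ B.palette, B.count c T ≤ B.cap c := by
  simp only [excess, Finset.sum_eq_zero_iff, Nat.sub_eq_zero_iff_le]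

theorem excess_le_card (hT : B.IsBase T) : B.excess T ≤ T.card := by
  rw [Finset.card_eq_sum_card_fiberwise (t := B.palette) (f := B.color)
    fun j hj => B.color_mem (B.subset_ground hT hj)]
  exact Finset.sum_le_sum fun c _ => Nat.sub_le _ _

theorem isDual_zero (hS : MinWeight B.IsBase B.weight S) : B.IsDual 0 S where
  isMinBase := by
    rwa [IsMinBase, show B.penalized 0 = B.weight from funext fun _ => add_zero _]
  nonneg _ _ := le_rfl
  slack _ _ h := absurd rfl h

theorem sum_comp_color (hS : B.IsBase S) (g : κ → ℝ) :
    ∑ j ∈ S, g (B.color j) = ∑ c ∈ B.palette, B.count c S * g c := by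
  rw [← Finset.sum_fiberwise_of_maps_to (t := B.palette) (g := B.color)
    fun j hj => B.color_mem (B.subset_ground hS hj)]
  refine Finset.sum_congr rfl fun c _ => ?_
  rw [Finset.sum_congr rfl fun j hj => by rw [(Finset.mem_filter.1 hj).2], Finset.sum_const,
    nsmul_eq_mul, count]

theorem count_insert (hf : f ∉ S) (c : κ) :
    B.count c (insert f S) = B.count c S + if c = B.color f then 1 else 0 := by
  simp only [count, Finset.card_filter, eq_comm (a := c)]
  rw [Finset.sum_insert hf, add_comm]

theorem count_insert_erase (he : e ∈ S) (hf : f ∉ S) (c : κ) :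
    B.count c (insert f (S.erase e)) + (if c = B.color e then 1 else 0) =
      B.count c S + if c = B.color f then 1 else 0 := by
  rw [count_insert fun h => hf (Finset.mem_of_mem_erase h), add_right_comm,
    ← count_insert (Finset.notMem_erase e S), Finset.insert_erase he]

theorem IsDual.weight_le (h : B.IsDual lam T) (hT : B.IsFeasible T) (hT' : B.IsFeasible T') :
    ∑ j ∈ T, B.weight j ≤ ∑ j ∈ T', B.weight j := by
  have hmin := h.isMinBase.2 T' hT'.1
  simp only [penalized, Finset.sum_add_distrib, sum_comp_color hT.1, sum_comp_color hT'.1] at hmin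
  have hpenalty : ∑ c ∈ B.palette, (B.count c T' : ℝ) * lam c ≤
      ∑ c ∈ B.palette, (B.count c T : ℝ) * lam c := by
    refine Finset.sum_le_sum fun c hc => ?_
    by_cases h0 : lam c = 0
    · simp [h0]
    · refine mul_le_mul_of_nonneg_right ?_ (h.nonneg c hc)
      exact_mod_cast (hT'.2 c hc).trans (h.slack c hc h0)
  linarith

/-- `T` has as many elements with colours in `P` as possible, since it is a base of minimum weight
for the indicator function of `P`. -/
theorem not_isFeasible_of_closed (hT : B.IsBase T) {P : κ → Prop}
    (hP : ∀ e f, B.Exchangeable T e f → P (B.color e) → P (B.color f))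
    (hcap : ∀ c ∈ B.palette, P c → B.cap c ≤ B.count c T) (hc : c ∈ B.palette) (hPc : P c)
    (hover : B.cap c < B.count c T) : ¬ B.IsFeasible T' := by
  classical
  intro hT'
  have hmin : MinWeight B.IsBase (fun j => if P (B.color j) then (1 : ℝ) else 0) T := by
    refine B.symmExchange.minWeight_of_forall_insert_erase hT fun e he f _ hef => ?_
    have := hP e f ⟨he, hef⟩
    split_ifs with hPe hPf
    exacts [le_rfl, absurd (this hPe) hPf, zero_le_one, le_rfl]
  have hle := hmin.2 T' hT'.1
  rw [sum_comp_color hT fun c => if P c then (1 : ℝ) else 0,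
    sum_comp_color hT'.1 fun c => if P c then (1 : ℝ) else 0] at hle
  refine absurd hle (not_le.2 (Finset.sum_lt_sum (fun b hb => ?_) ⟨c, hc, ?_⟩))
  · split_ifs with hPb
    · rw [mul_one, mul_one]
      exact_mod_cast (hT'.2 b hb).trans (hcap b hb hPb)
    · simp
  · rw [if_pos hPc, mul_one, mul_one]
    exact_mod_cast (hT'.2 c hc).trans_lt hover

end Bounds

/-! ### The search for an augmenting path of colours -/

section Search

variable {rank : κ → ℕ} {out inn : κ → ι} {r : ℕ} {d : ℝ}

variable (B) in
/-- The exchanges that remove an element of a colour of rank `0` and insert an element of a colour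
of positive rank. -/
def candidates (T : Finset ι) (rank : κ → ℕ) : Set (ι × ι) :=
  {p | B.Exchangeable T p.1 p.2 ∧ rank (B.color p.1) = 0 ∧ 1 ≤ rank (B.color p.2)}

variable (B) in
/-- The change of the penalized weight by the exchange of `e` for `f`. -/
def gap (lam : κ → ℝ) (e f : ι) : ℝ := B.penalized lam f - B.penalized lam e

variable (B) in
/-- Exchanges are compared by their gaps, and by the rank of the inserted element in case of a
tie. -/
def key (lam : κ → ℝ) (rank : κ → ℕ) (p : ι × ι) : ℝ ×ₗ ℕ :=
  toLex (B.gap lam p.1 p.2, rank (B.color p.2))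

variable (B) in
/-- The exchange of `e` for `f` keeps the penalized weight and leads from the colour `c` to a
colour of smaller positive rank, which is the smallest rank that can be reached in this way. -/
structure IsExit (T : Finset ι) (lam : κ → ℝ) (rank : κ → ℕ) (c : κ) (e f : ι) : Prop where
  color_eq : B.color e = c
  exchange : B.Exchangeable T e f
  tight : B.penalized lam f = B.penalized lam e
  pos : 1 ≤ rank (B.color f)
  lt : rank (B.color f) < rank c
  first : ∀ e' f', B.Exchangeable T e' f' → B.color e' = c → 1 ≤ rank (B.color f') →
    B.penalized lam f' = B.penalized lam e' → rank (B.color f) ≤ rank (B.color f')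

theorem IsExit.notMem (h : B.IsExit T lam rank c e f) (hT : B.IsBase T) : f ∉ T :=
  h.exchange.notMem hT fun hef => h.lt.ne (hef ▸ congrArg rank h.color_eq)

variable [DecidableEq κ]

variable (B) in
/-- The penalties after an increase by `d` for the colours of rank `0`. -/
def raise (rank : κ → ℕ) (d : ℝ) (lam : κ → ℝ) (c : κ) : ℝ :=
  if c ∈ B.palette ∧ rank c = 0 then lam c + d else lam c

theorem penalized_raise (hj : j ∈ B.ground) :
    B.penalized (B.raise rank d lam) j =
      B.penalized lam j + if rank (B.color j) = 0 then d else 0 := by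
  simp only [penalized, raise, B.color_mem hj, true_and]
  split_ifs <;> ring

theorem IsDual.raise (h : B.IsDual lam T) (hd : 0 ≤ d)
    (hmin : ∀ p ∈ B.candidates T rank, d ≤ B.gap lam p.1 p.2)
    (hcap : ∀ c ∈ B.palette, rank c = 0 → B.cap c ≤ B.count c T) :
    B.IsDual (B.raise rank d lam) T where
  isMinBase := by
    refine isMinBase_of_forall_exchangeable h.isMinBase.1 fun e f hef => ?_
    have hle := h.isMinBase.penalized_le hef
    rw [penalized_raise (B.subset_ground h.isMinBase.1 hef.mem), penalized_raise hef.mem_ground]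
    split_ifs with he hf hf
    · linarith
    · have := hmin (e, f) ⟨hef, he, Nat.one_le_iff_ne_zero.2 hf⟩
      rw [gap] at this
      linarith
    · linarith
    · linarith
  nonneg c hc := by
    have := h.nonneg c hc
    rw [ColoredBases.raise]
    split_ifs <;> linarith
  slack c hc h0 := by
    rw [ColoredBases.raise] at h0
    split_ifs at h0 with hrank
    exacts [hcap c hc hrank.2, h.slack c hc h0]

theorem IsExit.raise {c₀ : κ} (h : B.IsExit T lam rank c e f) (hT : B.IsBase T)
    (hc : rank c ≤ r) (hc₀ : rank c₀ = 0) :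
    B.IsExit T (B.raise rank d lam) (Function.update rank c₀ (r + 1)) c e f := by
  have hrank_pos := h.pos.trans_lt h.lt
  have update_of_pos {b} (hb : 1 ≤ rank b) : Function.update rank c₀ (r + 1) b = rank b :=
    Function.update_of_ne (fun hbc => by subst hbc; lia) _ _
  have penalized_of_pos {j} (hj : j ∈ B.ground) (hpos : 1 ≤ rank (B.color j)) :
      B.penalized (B.raise rank d lam) j = B.penalized lam j := by
    rw [penalized_raise hj, if_neg (Nat.one_le_iff_ne_zero.1 hpos), add_zero]
  have hground {e f} (hef : B.Exchangeable T e f) : e ∈ B.ground := B.subset_ground hT hef.mem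
  refine ⟨h.color_eq, h.exchange, ?_, ?_, ?_, fun e' f' hef he' hf' htight => ?_⟩
  · rw [penalized_of_pos h.exchange.mem_ground h.pos,
      penalized_of_pos (hground h.exchange) (h.color_eq ▸ hrank_pos.le), h.tight]
  · rw [update_of_pos h.pos]
    exact h.pos
  · rw [update_of_pos h.pos, update_of_pos hrank_pos.le]
    exact h.lt
  · rw [update_of_pos h.pos]
    by_cases hnew : B.color f' = c₀
    · rw [hnew, Function.update_self]
      have := h.lt
      lia
    · rw [Function.update_of_ne hnew] at hf' ⊢
      rw [penalized_of_pos hef.mem_ground hf',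
        penalized_of_pos (hground hef) (he' ▸ hrank_pos.le)] at htight
      exact h.first e' f' hef he' hf' htight

theorem isExit_raise_gap (hT : B.IsBase T) (hef : (e, f) ∈ B.candidates T rank)
    (hmin : IsMinOn (B.key lam rank) (B.candidates T rank) (e, f)) (hr : rank (B.color f) ≤ r) :
    B.IsExit T (B.raise rank (B.gap lam e f) lam)
      (Function.update rank (B.color e) (r + 1)) (B.color e) e f := by
  obtain ⟨hex, he, hf⟩ := hef
  have hground {e f} (hef : B.Exchangeable T e f) : e ∈ B.ground := B.subset_ground hT hef.mem
  have hne : B.color f ≠ B.color e := fun h => by dsimp only at he hf; rw [h] at hf; lia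
  refine ⟨rfl, hex, ?_, ?_, ?_, fun e' f' hef' he' hf' htight => ?_⟩
  · rw [penalized_raise hex.mem_ground, penalized_raise (hground hex), if_pos he,
      if_neg (Nat.one_le_iff_ne_zero.1 hf), gap]
    ring
  · rwa [Function.update_of_ne hne]
  · rw [Function.update_of_ne hne, Function.update_self]
    exact Nat.lt_succ_of_le hr
  · rw [Function.update_of_ne hne]
    by_cases hnew : B.color f' = B.color e
    · rw [hnew, Function.update_self]
      exact hr.trans r.le_succ
    · rw [Function.update_of_ne hnew] at hf' ⊢
      rw [penalized_raise hef'.mem_ground, penalized_raise (hground hef'), he', if_pos he,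
        if_neg (Nat.one_le_iff_ne_zero.1 hf')] at htight
      have hle := isMinOn_iff.1 hmin (e', f') ⟨hef', by rw [he', he], hf'⟩
      exact (Prod.Lex.toLex_le_toLex'.1 hle).2 (by simp only [gap] at htight ⊢; linarith)

variable (B) in
/-- The state of the search after `r` rounds. The colours of rank `1` are those that are not used
up, the colours of larger rank have an exit, and no other colour has been reached. -/
structure Search (T : Finset ι) (lam : κ → ℝ) (rank : κ → ℕ) (out inn : κ → ι) (r : ℕ) :
    Prop where
  isDual : B.IsDual lam T
  rank_eq_one_iff : ∀ c ∈ B.palette, rank c = 1 ↔ B.count c T < B.cap c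
  rank_le : ∀ c ∈ B.palette, rank c ≤ r + 1
  isExit : ∀ c ∈ B.palette, 2 ≤ rank c → B.IsExit T lam rank c (out c) (inn c)
  closed_or_le_card : B.candidates T rank = ∅ ∨ r ≤ {c ∈ B.palette | 1 ≤ rank c}.card

namespace Search

theorem init (h : B.IsDual lam T)
    (hrank : ∀ c ∈ B.palette, rank c = if B.count c T < B.cap c then 1 else 0) :
    B.Search T lam rank out inn 0 where
  isDual := h
  rank_eq_one_iff c hc := by simp [hrank c hc]
  rank_le c hc := by rw [hrank c hc]; split_ifs <;> lia
  isExit c hc h2 := by rw [hrank c hc] at h2; split_ifs at h2 <;> lia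
  closed_or_le_card := .inr (Nat.zero_le _)

theorem cap_le (h : B.Search T lam rank out inn r) (hc : c ∈ B.palette) (h0 : rank c = 0) :
    B.cap c ≤ B.count c T := by
  have := h.rank_eq_one_iff c hc
  lia

theorem succ_of_eq_empty (h : B.Search T lam rank out inn r) (hno : B.candidates T rank = ∅) :
    B.Search T lam rank out inn (r + 1) :=
  { h with
    rank_le := fun c hc => (h.rank_le c hc).trans (Nat.le_succ _)
    closed_or_le_card := .inl hno }

theorem succ_of_isMinOn (h : B.Search T lam rank out inn r)
    (hef : (e, f) ∈ B.candidates T rank)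
    (hmin : IsMinOn (B.key lam rank) (B.candidates T rank) (e, f)) :
    B.Search T (B.raise rank (B.gap lam e f) lam) (Function.update rank (B.color e) (r + 2))
      (Function.update out (B.color e) e) (Function.update inn (B.color e) f) (r + 1) := by
  have hT := h.isDual.isMinBase.1
  have hex := hef.1
  have he : rank (B.color e) = 0 := hef.2.1
  have hce := B.color_mem (B.subset_ground hT hex.mem)
  have hgap : ∀ p ∈ B.candidates T rank, B.gap lam e f ≤ B.gap lam p.1 p.2 := fun p hp =>
    (Prod.Lex.toLex_le_toLex'.1 (isMinOn_iff.1 hmin p hp)).1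
  refine ⟨h.isDual.raise (sub_nonneg.2 (h.isDual.isMinBase.penalized_le hex)) hgap
    fun c => h.cap_le, fun c hc => ?_, fun c hc => ?_, fun c hc h2 => ?_, .inr ?_⟩
  · rcases eq_or_ne c (B.color e) with rfl | hne
    · have := h.cap_le hce he
      rw [Function.update_self]
      lia
    · rw [Function.update_of_ne hne, h.rank_eq_one_iff c hc]
  · rcases eq_or_ne c (B.color e) with rfl | hne
    · rw [Function.update_self]
    · rw [Function.update_of_ne hne]
      exact (h.rank_le c hc).trans (Nat.le_succ _)
  · rcases eq_or_ne c (B.color e) with rfl | hne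
    · simpa only [Function.update_self] using
        isExit_raise_gap hT hef hmin (h.rank_le _ (B.color_mem hex.mem_ground))
    · simp only [Function.update_of_ne hne] at h2 ⊢
      exact (h.isExit c hc h2).raise hT (h.rank_le c hc) he
  · have hle := h.closed_or_le_card.resolve_left (Set.nonempty_of_mem hef).ne_empty
    have hsub : insert (B.color e) {c ∈ B.palette | 1 ≤ rank c} ⊆
        {c ∈ B.palette | 1 ≤ Function.update rank (B.color e) (r + 2) c} := by
      intro c
      rcases eq_or_ne c (B.color e) with rfl | hne
      · simp [hce]
      · simp [hne]
    have := Finset.card_le_card hsub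
    rw [Finset.card_insert_of_notMem (by simp [he])] at this
    lia

theorem not_isFeasible (h : B.Search T lam rank out inn B.palette.card) (hc : c ∈ B.palette)
    (hover : B.cap c < B.count c T) (h0 : rank c = 0) : ¬ B.IsFeasible T' := by
  have hclosed : B.candidates T rank = ∅ := by
    refine h.closed_or_le_card.resolve_right (not_le.2 (Finset.card_lt_card ?_))
    exact Finset.filter_ssubset.2 ⟨c, hc, by lia⟩
  refine not_isFeasible_of_closed (P := fun c => rank c = 0) h.isDual.isMinBase.1
    (fun e f hef he => ?_) (fun b => h.cap_le) hc h0 hover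
  by_contra hf
  exact hclosed.subset (show (e, f) ∈ B.candidates T rank from ⟨hef, he, Nat.pos_of_ne_zero hf⟩)

end Search

/-! ### Augmentation along a path of colours -/

variable (B) in
/-- The exits of the colour `b` can still be used on a path that has arrived at the colour `c`. -/
structure Pending (rank : κ → ℕ) (c b : κ) : Prop where
  mem : b ∈ B.palette
  two_le : 2 ≤ rank b
  rank_le : rank b ≤ rank c

variable (B) in
/-- The base `S` arises from `T` by the exchanges on the path of exits from the colour `c₀` to the
colour `c`. By `triangular`, the remaining exchanges do not interfere with each other. -/
structure Walk (T : Finset ι) (lam : κ → ℝ) (rank : κ → ℕ) (out inn : κ → ι) (c₀ : κ)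
    (S : Finset ι) (c : κ) : Prop where
  isMinBase : B.IsMinBase lam S
  count_add : ∀ b, B.count b S + (if b = c₀ then 1 else 0) =
    B.count b T + if b = c then 1 else 0
  mem_palette : c ∈ B.palette
  pos : 1 ≤ rank c
  mem : ∀ b, B.Pending rank c b → out b ∈ S
  notMem : ∀ b, B.Pending rank c b → inn b ∉ S
  exchange : ∀ b, B.Pending rank c b → B.IsMinBase lam (insert (inn b) (S.erase (out b)))
  triangular : ∀ a b, B.Pending rank c a → B.Pending rank c b →
    rank (B.color (inn b)) < rank (B.color (inn a)) →
    ¬ B.IsMinBase lam (insert (inn b) (S.erase (out a)))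

variable {c₀ : κ}

theorem Search.walk (h : B.Search T lam rank out inn r) (hc : c ∈ B.palette)
    (hpos : 1 ≤ rank c) : B.Walk T lam rank out inn c T c := by
  have hT := h.isDual.isMinBase
  have hexit b (hb : B.Pending rank c b) := h.isExit b hb.mem hb.two_le
  refine ⟨hT, fun _ => rfl, hc, hpos, fun b hb => (hexit b hb).exchange.mem,
    fun b hb => (hexit b hb).notMem hT.1, fun b hb => ?_, fun a b ha hb hlt hmin => ?_⟩
  · exact (hT.exchange_iff (hexit b hb).exchange.mem ((hexit b hb).notMem hT.1)).2
      ⟨(hexit b hb).exchange, (hexit b hb).tight⟩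
  · obtain ⟨hex, htight⟩ :=
      (hT.exchange_iff (hexit a ha).exchange.mem ((hexit b hb).notMem hT.1)).1 hmin
    exact hlt.not_ge ((hexit a ha).first _ _ hex (hexit a ha).color_eq (hexit b hb).pos htight)

namespace Walk

theorem step (h : B.Search T lam rank out inn r) (hw : B.Walk T lam rank out inn c₀ S c)
    (h2 : 2 ≤ rank c) :
    B.Walk T lam rank out inn c₀ (insert (inn c) (S.erase (out c))) (B.color (inn c)) := by
  have hexit := h.isExit c hw.mem_palette h2
  have hc : B.Pending rank c c := ⟨hw.mem_palette, h2, le_rfl⟩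
  have hmem := hw.mem c hc
  have hnotMem := hw.notMem c hc
  have pending {b} (hb : B.Pending rank (B.color (inn c)) b) : B.Pending rank c b :=
    ⟨hb.mem, hb.two_le, hb.rank_le.trans hexit.lt.le⟩
  have out_ne {b} (hb : B.Pending rank (B.color (inn c)) b) : out c ≠ out b := by
    intro heq
    have hcb : c = b := by
      rw [← hexit.color_eq, heq, (h.isExit b hb.mem hb.two_le).color_eq]
    exact (hb.rank_le.trans_lt hexit.lt).ne (hcb ▸ rfl)
  have lt_of_pending {b} (hb : B.Pending rank (B.color (inn c)) b) :
      rank (B.color (inn b)) < rank (B.color (inn c)) :=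
    (h.isExit b hb.mem hb.two_le).lt.trans_le hb.rank_le
  have inn_ne {b} (hb : B.Pending rank (B.color (inn c)) b) : inn c ≠ inn b := fun heq =>
    (lt_of_pending hb).ne (heq ▸ rfl)
  have blocked {b} (hb : B.Pending rank (B.color (inn c)) b) :
      ¬ B.IsMinBase lam (insert (inn b) (S.erase (out c))) :=
    hw.triangular c b hc (pending hb) (lt_of_pending hb)
  have hsymm : SymmExchange (B.IsMinBase lam) := B.symmExchange.minWeight _
  refine ⟨hw.exchange c hc, fun b => ?_, B.color_mem hexit.exchange.mem_ground, hexit.pos,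
    fun b hb => ?_, fun b hb => ?_, fun b hb => ?_, fun a b ha hb hlt => ?_⟩
  · have hcount := hw.count_add b
    have hstep := count_insert_erase (B := B) hmem hnotMem b
    rw [hexit.color_eq] at hstep
    lia
  · exact Finset.mem_insert_of_mem (Finset.mem_erase.2
      ⟨(out_ne hb).symm, hw.mem b (pending hb)⟩)
  · rw [Finset.mem_insert, Finset.mem_erase]
    rintro (heq | ⟨-, hS⟩)
    exacts [inn_ne hb heq.symm, hw.notMem b (pending hb) hS]
  · exact hsymm.insert_erase_insert_erase hnotMem hmem (hw.notMem b (pending hb))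
      (hw.mem b (pending hb)) (inn_ne hb) (out_ne hb) (hw.exchange c hc) (blocked hb)
      (hw.exchange b (pending hb))
  · exact hsymm.not_insert_erase_insert_erase hw.isMinBase (hw.notMem b (pending hb))
      (blocked hb) (hw.triangular a b (pending ha) (pending hb) hlt)

theorem isDual_and_excess_lt (h : B.Search T lam rank out inn r)
    (hw : B.Walk T lam rank out inn c₀ S c) (hc₀ : c₀ ∈ B.palette)
    (hover : B.cap c₀ < B.count c₀ T) (hc : rank c = 1) :
    B.IsDual lam S ∧ B.excess S < B.excess T := by
  have hroom := (h.rank_eq_one_iff c hw.mem_palette).1 hc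
  have hcc₀ : c ≠ c₀ := fun heq => by subst heq; lia
  have hcount b : b = c₀ ∧ B.count b S + 1 = B.count b T ∨
      b = c ∧ B.count b S = B.count b T + 1 ∨ b ≠ c₀ ∧ B.count b S = B.count b T := by
    have := hw.count_add b
    grind
  refine ⟨⟨hw.isMinBase, h.isDual.nonneg, fun b hb h0 => ?_⟩,
    Finset.sum_lt_sum (fun b _ => ?_) ⟨c₀, hc₀, ?_⟩⟩
  · have := h.isDual.slack b hb h0
    grind
  · grind
  · grind

end Walk

end Search

end ColoredBases

end GDC

namespace RealRAM

/-! ### Programs with bounded loops -/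

/-- The cell `0` of the array `a`, used as a variable. -/
def NatExpr.var (a : ℕ) : NatExpr := .get a (.lit 0)

@[simp]
theorem NatExpr.eval_var (s : Mem) (a : ℕ) : (NatExpr.var a).eval s = s.nat a 0 := rfl

/-- Equality of natural numbers as a test. -/
def Cond.natEq (x y : NatExpr) : Cond := .and (.natLe x y) (.natLe y x)

@[simp]
theorem Cond.holds_natEq {s : Mem} {x y : NatExpr} :
    (Cond.natEq x y).Holds s ↔ x.eval s = y.eval s :=
  le_antisymm_iff.symm

@[simp]
theorem Mem.nat_writeNat (s : Mem) (a i x b : ℕ) :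
    (s.writeNat a i x).nat b = if b = a then Function.update (s.nat a) i x else s.nat b := by
  simp [Mem.writeNat, Function.update_apply]

@[simp]
theorem Mem.real_writeNat (s : Mem) (a i x : ℕ) : (s.writeNat a i x).real = s.real := rfl

@[simp]
theorem Mem.real_writeReal (s : Mem) (a i : ℕ) (x : ℝ) (b : ℕ) :
    (s.writeReal a i x).real b = if b = a then Function.update (s.real a) i x else s.real b := by
  simp [Mem.writeReal, Function.update_apply]

@[simp]
theorem Mem.nat_writeReal (s : Mem) (a i : ℕ) (x : ℝ) : (s.writeReal a i x).nat = s.nat := rfl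

/-- Disjunction of tests. -/
def Cond.or (c d : Cond) : Cond := .not (.and (.not c) (.not d))

@[simp]
theorem Cond.holds_or {s : Mem} {c d : Cond} : (c.or d).Holds s ↔ c.Holds s ∨ d.Holds s :=
  or_iff_not_and_not.symm

/-- Programs that always halt. The loop `loopTo v k d p` runs `p` with the counter `v` running
through the numbers below `N - d`, where `N` is the cell `k` of the array `0`, so the array `0` of
the input bounds the number of rounds of every loop. -/
inductive Block where
  | skip
  | setNat (a : ℕ) (i x : NatExpr)
  | setReal (a : ℕ) (i : NatExpr) (x : RealExpr)
  | seq (p q : Block)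
  | ite (c : Cond) (p q : Block)
  | loopTo (v k d : ℕ) (p : Block)

namespace Block

/-- Assignment to a variable. -/
def assign (v : ℕ) (x : NatExpr) : Block := .setNat v (.lit 0) x

/-- The guard of a bounded loop. -/
def counterLt (v k d : ℕ) : Cond :=
  .natLe (.add (.var v) (.lit 1)) (.sub (.get 0 (.lit k)) (.lit d))

/-- The program of the machine that a block stands for. -/
def compile : Block → Program
  | skip => .skip
  | setNat a i x => .setNat a i x
  | setReal a i x => .setReal a i x
  | seq p q => .seq p.compile q.compile
  | ite c p q => .branch c p.compile q.compile
  | loopTo v k d p => .seq (.setNat v (.lit 0) (.lit 0)) (.loop (counterLt v k d)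
      (.seq p.compile (.setNat v (.lit 0) (.add (.var v) (.lit 1)))))

open Classical in
/-- The memory after the execution. The number of rounds of a loop is read off once, at its start:
this agrees with the compiled program as long as array `0` and the counter are not written. -/
noncomputable def run : Block → Mem → Mem
  | skip, s => s
  | setNat a i x, s => s.writeNat a (i.eval s) (x.eval s)
  | setReal a i x, s => s.writeReal a (i.eval s) (x.eval s)
  | seq p q, s => q.run (p.run s)
  | ite c p q, s => if c.Holds s then p.run s else q.run s
  | loopTo v k d p, s =>
      (fun s => (p.run s).writeNat v 0 ((p.run s).nat v 0 + 1))^[s.nat 0 k - d] (s.writeNat v 0 0)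

/-- One round of a loop with body `p` and counter `v`. -/
noncomputable def round (p : Block) (v : ℕ) (s : Mem) : Mem :=
  (p.run s).writeNat v 0 ((p.run s).nat v 0 + 1)

/-- The array `a` of natural numbers is not written. -/
def keepsNat (a : ℕ) : Block → Bool
  | skip => true
  | setNat b _ _ => a != b
  | setReal _ _ _ => true
  | seq p q => p.keepsNat a && q.keepsNat a
  | ite _ p q => p.keepsNat a && q.keepsNat a
  | loopTo v _ _ p => a != v && p.keepsNat a

/-- The array `a` of real numbers is not written. -/
def keepsReal (a : ℕ) : Block → Bool
  | skip => true
  | setNat _ _ _ => true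
  | setReal b _ _ => a != b
  | seq p q => p.keepsReal a && q.keepsReal a
  | ite _ p q => p.keepsReal a && q.keepsReal a
  | loopTo _ _ _ p => p.keepsReal a

/-- No loop writes its own counter. -/
def keepsCounters : Block → Bool
  | skip => true
  | setNat _ _ _ => true
  | setReal _ _ _ => true
  | seq p q => p.keepsCounters && q.keepsCounters
  | ite _ p q => p.keepsCounters && q.keepsCounters
  | loopTo v _ _ p => p.keepsNat v && p.keepsCounters

open Polynomial in
/-- A bound for the running time in terms of a bound for the entries of the array `0`. The constants
of a loop account for the guard, the increment of the counter and its initialization. -/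
noncomputable def time : Block → ℕ[X]
  | skip => 1
  | setNat _ i x => C (i.cost + x.cost + 1)
  | setReal _ i x => C (i.cost + x.cost + 1)
  | seq p q => p.time + q.time
  | ite c p q => C (c.cost + 1) + p.time + q.time
  | loopTo v k d p => X * (p.time + C ((counterLt v k d).cost + 7)) +
      C ((counterLt v k d).cost + 4)

section Run

variable {s : Mem}

@[simp] theorem run_skip : skip.run s = s := rfl

@[simp] theorem run_setNat (a : ℕ) (i x : NatExpr) :
    (setNat a i x).run s = s.writeNat a (i.eval s) (x.eval s) := rfl

@[simp] theorem run_assign (v : ℕ) (x : NatExpr) :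
    (assign v x).run s = s.writeNat v 0 (x.eval s) := rfl

@[simp] theorem run_setReal (a : ℕ) (i : NatExpr) (x : RealExpr) :
    (setReal a i x).run s = s.writeReal a (i.eval s) (x.eval s) := rfl

@[simp] theorem run_seq (p q : Block) : (seq p q).run s = q.run (p.run s) := rfl

theorem run_ite_pos {c : Cond} (h : c.Holds s) (p q : Block) : (ite c p q).run s = p.run s :=
  if_pos h

theorem run_ite_neg {c : Cond} (h : ¬ c.Holds s) (p q : Block) : (ite c p q).run s = q.run s :=
  if_neg h

theorem run_loopTo (v k d : ℕ) (p : Block) :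
    (loopTo v k d p).run s = (p.round v)^[s.nat 0 k - d] (s.writeNat v 0 0) := rfl

end Run

/-- The arrays that `p` does not write agree. -/
structure Frame (p : Block) (s s' : Mem) : Prop where
  nat : ∀ a, p.keepsNat a = true → s'.nat a = s.nat a
  real : ∀ a, p.keepsReal a = true → s'.real a = s.real a

namespace Frame

variable {p q : Block} {s s' s'' : Mem}

theorem trans (h : p.Frame s s') (h' : p.Frame s' s'') : p.Frame s s'' where
  nat a ha := (h'.nat a ha).trans (h.nat a ha)
  real a ha := (h'.real a ha).trans (h.real a ha)

theorem mono (h : p.Frame s s') (hnat : ∀ a, q.keepsNat a = true → p.keepsNat a = true)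
    (hreal : ∀ a, q.keepsReal a = true → p.keepsReal a = true) : q.Frame s s' where
  nat a ha := h.nat a (hnat a ha)
  real a ha := h.real a (hreal a ha)

theorem seq (hp : p.Frame s s') (hq : q.Frame s' s'') : (p.seq q).Frame s s'' :=
  (hp.mono (by simp +contextual [keepsNat]) (by simp +contextual [keepsReal])).trans
    (hq.mono (by simp +contextual [keepsNat]) (by simp +contextual [keepsReal]))

theorem loopTo_writeNat (v k d : ℕ) (p : Block) (s : Mem) (x : ℕ) :
    (loopTo v k d p).Frame s (s.writeNat v 0 x) where
  nat a ha := by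
    simp only [keepsNat, Bool.and_eq_true, bne_iff_ne] at ha
    simp [ha.1]
  real _ _ := rfl

theorem loopTo_round {v : ℕ} (h : p.Frame s (p.run s)) (k d : ℕ) :
    (loopTo v k d p).Frame s (p.round v s) :=
  (h.mono (by simp +contextual [keepsNat]) (by simp [keepsReal])).trans
    (loopTo_writeNat v k d p _ _)

end Frame

theorem frame_run (p : Block) (s : Mem) : p.Frame s (p.run s) := by
  induction p generalizing s with
  | skip => exact ⟨fun _ _ => rfl, fun _ _ => rfl⟩
  | setNat b i x =>
    refine ⟨fun a h => ?_, fun _ _ => rfl⟩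
    simp only [keepsNat, bne_iff_ne] at h
    simp [h]
  | setReal b i x =>
    refine ⟨fun _ _ => rfl, fun a h => ?_⟩
    simp only [keepsReal, bne_iff_ne] at h
    simp [h]
  | seq p q ihp ihq => exact (ihp s).seq (ihq _)
  | ite c p q ihp ihq =>
    rw [run]
    split_ifs
    · exact (ihp s).mono (by simp +contextual [keepsNat]) (by simp +contextual [keepsReal])
    · exact (ihq s).mono (by simp +contextual [keepsNat]) (by simp +contextual [keepsReal])
  | loopTo v k d p ih =>
    rw [run_loopTo]
    generalize s.nat 0 k - d = N
    induction N with
    | zero => exact .loopTo_writeNat ..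
    | succ N ihN =>
      rw [Function.iterate_succ_apply']
      exact ihN.trans ((ih _).loopTo_round k d)

theorem nat_run (p : Block) (s : Mem) (a : ℕ) (h : p.keepsNat a = true := by rfl) :
    (p.run s).nat a = s.nat a :=
  (frame_run p s).nat a h

theorem real_run (p : Block) (s : Mem) (a : ℕ) (h : p.keepsReal a = true := by rfl) :
    (p.run s).real a = s.real a :=
  (frame_run p s).real a h

theorem nat_iterate_round {v : ℕ} {p : Block} (hv : p.keepsNat v = true) (s : Mem) (i : ℕ) :
    ((p.round v)^[i] s).nat v 0 = s.nat v 0 + i := by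
  induction i with
  | zero => rfl
  | succ i ih => simp [Function.iterate_succ_apply', round, nat_run p _ v hv, ih, add_assoc]

theorem frame_iterate_round (v k d : ℕ) (p : Block) (s : Mem) (i : ℕ) :
    (loopTo v k d p).Frame s ((p.round v)^[i] (s.writeNat v 0 0)) := by
  induction i with
  | zero => exact .loopTo_writeNat ..
  | succ i ih =>
    rw [Function.iterate_succ_apply']
    exact ih.trans ((frame_run p _).loopTo_round k d)

/-- The invariant `I` may not depend on the counter, which is what `hw` says. -/
theorem loopTo_induction {v k d : ℕ} {p : Block} {s : Mem} (I : ℕ → Mem → Prop)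
    (hv : p.keepsNat v = true) (hw : ∀ i s' x, I i s' → I i (s'.writeNat v 0 x)) (h0 : I 0 s)
    (hstep : ∀ i s', i < s.nat 0 k - d → s'.nat v 0 = i → (loopTo v k d p).Frame s s' → I i s' →
      I (i + 1) (p.run s')) :
    I (s.nat 0 k - d) ((loopTo v k d p).run s) := by
  have key (i : ℕ) (hi : i ≤ s.nat 0 k - d) : I i ((p.round v)^[i] (s.writeNat v 0 0)) := by
    induction i with
    | zero => exact hw _ _ _ h0
    | succ i ih =>
      rw [Function.iterate_succ_apply']
      exact hw _ _ _ (hstep i _ hi (by simp [nat_iterate_round hv])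
        (frame_iterate_round v k d p s i) (ih (Nat.le_of_succ_le hi)))
  exact key _ le_rfl

theorem exists_runs_loop {v k d : ℕ} {p : Block} (hv : p.keepsNat v = true)
    (hv0 : (loopTo v k d p).keepsNat 0 = true) {N t : ℕ}
    (hp : ∀ s, (∀ k, s.nat 0 k ≤ N) → ∃ t' ≤ t, Runs p.compile s t' (p.run s)) (j : ℕ) {s : Mem}
    (hs : ∀ k, s.nat 0 k ≤ N) (hj : s.nat v 0 + j = s.nat 0 k - d) :
    ∃ t' ≤ j * (t + ((counterLt v k d).cost + 7)) + ((counterLt v k d).cost + 1),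
      Runs (.loop (counterLt v k d)
        (.seq p.compile (.setNat v (.lit 0) (.add (.var v) (.lit 1))))) s t'
        ((p.round v)^[j] s) := by
  induction j generalizing s with
  | zero =>
    refine ⟨_, by simp, .loopFalse ?_⟩
    simp only [counterLt, Cond.Holds, NatExpr.eval, NatExpr.eval_var]
    lia
  | succ j ih =>
    obtain ⟨t₁, ht₁, h₁⟩ := hp s hs
    have harray : (p.round v s).nat 0 = s.nat 0 :=
      ((frame_run p s).loopTo_round k d).nat 0 hv0
    have hcounter : (p.round v s).nat v 0 = s.nat v 0 + 1 := nat_iterate_round hv s 1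
    obtain ⟨t₂, ht₂, h₂⟩ := ih (s := p.round v s) (by simpa [harray] using hs)
      (by rw [harray, hcounter]; lia)
    rw [Function.iterate_succ_apply]
    refine ⟨_, ?_, .loopTrue ?_ (.seq h₁ (.setNat v (.lit 0) (.add (.var v) (.lit 1)) _)) h₂⟩
    · simp only [NatExpr.cost, NatExpr.var]
      rw [Nat.add_mul]
      lia
    · simp only [counterLt, Cond.Holds, NatExpr.eval, NatExpr.eval_var]
      lia

theorem exists_runs {p : Block} (hcount : p.keepsCounters = true) (h0 : p.keepsNat 0 = true)
    {N : ℕ} {s : Mem} (hs : ∀ k, s.nat 0 k ≤ N) :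
    ∃ t ≤ p.time.eval N, Runs p.compile s t (p.run s) := by
  induction p generalizing s with
  | skip => exact ⟨1, by simp [time], .skip s⟩
  | setNat a i x => exact ⟨_, by simp [time], .setNat a i x s⟩
  | setReal a i x => exact ⟨_, by simp [time], .setReal a i x s⟩
  | seq p q ihp ihq =>
    simp only [keepsCounters, keepsNat, Bool.and_eq_true] at hcount h0
    obtain ⟨t, ht, h⟩ := ihp hcount.1 h0.1 hs
    obtain ⟨t', ht', h'⟩ := ihq hcount.2 h0.2 (s := p.run s) (by rwa [nat_run p s 0 h0.1])
    exact ⟨t + t', by rw [time, Polynomial.eval_add]; lia, .seq h h'⟩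
  | ite c p q ihp ihq =>
    simp only [keepsCounters, keepsNat, Bool.and_eq_true] at hcount h0
    rw [run, time, Polynomial.eval_add, Polynomial.eval_add, Polynomial.eval_C]
    split_ifs with hc
    · obtain ⟨t, ht, h⟩ := ihp hcount.1 h0.1 hs
      exact ⟨_, by lia, .branchTrue hc h⟩
    · obtain ⟨t, ht, h⟩ := ihq hcount.2 h0.2 hs
      exact ⟨_, by lia, .branchFalse hc h⟩
  | loopTo v k d p ih =>
    have h0' := h0
    simp only [keepsCounters, keepsNat, Bool.and_eq_true, bne_iff_ne] at hcount h0
    obtain ⟨t, ht, h⟩ := exists_runs_loop hcount.1 h0' (fun s hs => ih hcount.2 h0.2 hs)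
      (s.nat 0 k - d) (s := s.writeNat v 0 0) (by simpa [h0.1] using hs) (by simp [h0.1])
    refine ⟨_, ?_, .seq (.setNat v (.lit 0) (.lit 0) s) h⟩
    have hrounds := Nat.mul_le_mul_right (p.time.eval N + ((counterLt v k d).cost + 7))
      ((Nat.sub_le _ d).trans (hs k))
    simp only [time, Polynomial.eval_add, Polynomial.eval_mul, Polynomial.eval_X,
      Polynomial.eval_C, NatExpr.cost]
    lia

end Block

end RealRAM

namespace GDC

open RealRAM

/-! ### Loops that fill an array or search a minimum -/

/-- The elements of `Q` at which `key` is minimal, as the possible results of a search in `Q`: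
`none` stands for an empty `Q`. -/
def IsArgmin {α β : Type*} [Preorder β] (key : α → β) (Q : Set α) : Option α → Prop
  | none => Q = ∅
  | some p => p ∈ Q ∧ IsMinOn key Q p

section IsArgmin

variable {α β : Type*} [LinearOrder β] {key : α → β} {Q : Set α} {o : Option α} {p : α}

open Classical in
theorem IsArgmin.insert (h : IsArgmin key Q o) :
    IsArgmin key (insert p Q) (if ∀ q ∈ o, key p < key q then some p else o) := by
  cases o with
  | none =>
    obtain rfl : Q = ∅ := h
    simp [IsArgmin, isMinOn_iff]
  | some q =>
    obtain ⟨hq, hmin⟩ := h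
    rw [isMinOn_iff] at hmin
    by_cases hlt : key p < key q
    · simpa [hlt, IsArgmin, isMinOn_iff] using fun r hr => hlt.le.trans (hmin r hr)
    · simpa [hlt, IsArgmin, isMinOn_iff, hq] using ⟨not_lt.1 hlt, hmin⟩

end IsArgmin

end GDC

namespace RealRAM.Block

variable {v k d a : ℕ} {p : Block} {s : Mem}

theorem nat_loopTo_eq_ite (hv : p.keepsNat v = true) (ha : a ≠ v) (g : ℕ → ℕ)
    (hp : ∀ i s', i < s.nat 0 k - d → s'.nat v 0 = i → (loopTo v k d p).Frame s s' →
      s'.nat a i = s.nat a i → (p.run s').nat a = Function.update (s'.nat a) i (g i)) (j : ℕ) :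
    ((loopTo v k d p).run s).nat a j = if j < s.nat 0 k - d then g j else s.nat a j := by
  refine loopTo_induction (fun i s' => ∀ j, s'.nat a j = if j < i then g j else s.nat a j) hv
    (fun i s' x h => by simpa [ha] using h) (by simp) (fun i s' hi hc hf h => ?_) j
  rw [hp i s' hi hc hf (by simp [h])]
  intro j
  rcases lt_trichotomy j i with hj | rfl | hj
  · simp [h, hj.ne, hj, hj.trans (Nat.lt_succ_self i)]
  · simp
  · simp [h, hj.ne', hj.not_gt, (Nat.succ_le_of_lt hj).not_gt]

open Classical in
/-- The loop examines the elements `g i` that satisfy `P i`, in addition to `Q`; `R s' o` says how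
the best element found so far is stored in the memory. -/
theorem loopTo_isArgmin {α β : Type*} [LinearOrder β] {key : α → β} {Q : Set α}
    (R : Mem → Option α → Prop) (g : ℕ → α) (P : ℕ → Prop) (hv : p.keepsNat v = true)
    (hw : ∀ s' o x, R s' o → R (s'.writeNat v 0 x) o) {o : Option α} (hs : R s o)
    (ho : GDC.IsArgmin key Q o)
    (hp : ∀ i s' o, i < s.nat 0 k - d → s'.nat v 0 = i → (loopTo v k d p).Frame s s' → R s' o →
      R (p.run s') (if P i ∧ ∀ q ∈ o, key (g i) < key q then some (g i) else o)) :
    ∃ o, R ((loopTo v k d p).run s) o ∧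
      GDC.IsArgmin key (Q ∪ {q | ∃ i < s.nat 0 k - d, P i ∧ q = g i}) o := by
  refine loopTo_induction (fun i s' => ∃ o, R s' o ∧
    GDC.IsArgmin key (Q ∪ {q | ∃ j < i, P j ∧ q = g j}) o) hv
    (fun i s' x ⟨o, h, ho⟩ => ⟨o, hw s' o x h, ho⟩) ⟨o, hs, by simpa using ho⟩
    fun i s' hi hc hf ⟨o, h, ho⟩ => ⟨_, hp i s' o hi hc hf h, ?_⟩
  simp only [Nat.exists_lt_succ_right]
  by_cases hPi : P i
  · have hset : Q ∪ {q | (∃ j < i, P j ∧ q = g j) ∨ q = g i} =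
        insert (g i) (Q ∪ {q | ∃ j < i, P j ∧ q = g j}) := by
      ext q
      exact or_assoc.symm.trans or_comm
    simpa only [hPi, true_and, hset] using ho.insert (p := g i)
  · simpa only [hPi, false_and, or_false, if_false] using ho

end RealRAM.Block

namespace GDC

open RealRAM

/-! ### Components and minimum spanning trees on the machine -/

/-- A multigraph with vertices `0, …, n - 1` and weighted and coloured edges `0, …, m - 1`; the
colours are numbers below `m`, too, and a tree may have at most `bound c + 1` edges of
colour `c`. -/
structure Net where
  n : ℕ
  m : ℕ
  x : ℕ → ℕ
  y : ℕ → ℕ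
  bound : ℕ → ℕ
  color : ℕ → ℕ
  weight : ℕ → ℝ
  x_lt : ∀ j < m, x j < n
  y_lt : ∀ j < m, y j < n
  color_lt : ∀ j < m, color j < m

namespace Net

variable (N : Net)

/-- The spanning trees of the net are the bases of its graphic matroid. -/
def bases : ColoredBases ℕ ℕ where
  ground := .range N.m
  palette := .range N.m
  IsBase := IsSpanningTree (.range N.n) (.range N.m) N.x N.y
  color := N.color
  cap c := N.bound c + 1
  weight := N.weight
  subset_ground h := h.subset
  symmExchange := IsSpanningTree.symmExchange
    (by simpa using N.x_lt) (by simpa using N.y_lt)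
  color_mem hj := by simpa using N.color_lt _ (Finset.mem_range.1 hj)

/-- The edges marked by `1` in the array `g`. -/
def marked (g : ℕ → ℕ) : Finset ℕ := (Finset.range N.m).filter fun j => g j = 1

variable {N} {g : ℕ → ℕ} {i j : ℕ}

theorem mem_marked : j ∈ N.marked g ↔ j < N.m ∧ g j = 1 := by
  simp [marked]

theorem marked_subset : N.marked g ⊆ .range N.m := Finset.filter_subset _ _

theorem marked_update_one (hj : j < N.m) :
    N.marked (Function.update g j 1) = insert j (N.marked g) := by
  ext i
  by_cases h : i = j <;> simp [mem_marked, h, hj]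

theorem marked_update_zero : N.marked (Function.update g j 0) = (N.marked g).erase j := by
  ext i
  by_cases h : i = j <;> simp [mem_marked, h]

end Net

/-! Names of arrays and, from `20` on, of variables of the machine. -/

namespace Reg

abbrev sizes : ℕ := 0
abbrev ends₁ : ℕ := 1
abbrev ends₂ : ℕ := 2
abbrev tails : ℕ := 3
abbrev heads : ℕ := 4
abbrev bounds : ℕ := 6
abbrev answer : ℕ := 7
abbrev marks : ℕ := 8
abbrev colors : ℕ := 9
abbrev labels : ℕ := 11
abbrev counts : ℕ := 13
abbrev ranks : ℕ := 14
abbrev outs : ℕ := 15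
abbrev inns : ℕ := 16

abbrev edge : ℕ := 20
abbrev vertex : ℕ := 21
abbrev oldLabel : ℕ := 22
abbrev newLabel : ℕ := 23
abbrev lightest : ℕ := 24
abbrev index : ℕ := 25
abbrev counter : ℕ := 26
abbrev connected : ℕ := 27
abbrev edgeIn : ℕ := 28
abbrev edgeOut : ℕ := 29
abbrev bestOut : ℕ := 30
abbrev bestIn : ℕ := 31
abbrev searchRound : ℕ := 32
abbrev chosenColor : ℕ := 33
abbrev improveRound : ℕ := 34

abbrev weights : ℕ := 0
abbrev penalties : ℕ := 1
abbrev bestGap : ℕ := 2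

end Reg

open Reg

/-- A loop over the vertices, whose number is in the cell `0` of `sizes`. -/
abbrev forVertices (v : ℕ) (p : Block) : Block := .loopTo v 0 0 p

/-- A loop over the edges, whose number is in the cell `1` of `sizes`. -/
abbrev forEdges (v : ℕ) (p : Block) : Block := .loopTo v 1 0 p

/-- A loop over the arcs, whose number is in the cell `2` of `sizes`. -/
abbrev forArcs (v : ℕ) (p : Block) : Block := .loopTo v 2 0 p

/-- The memory holds the data of `N`. -/
structure Net.Loaded (N : Net) (s : Mem) : Prop where
  n : s.nat sizes 0 = N.n
  m : s.nat sizes 1 = N.m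
  x : s.nat ends₁ = N.x
  y : s.nat ends₂ = N.y
  bound : s.nat bounds = N.bound
  color : s.nat colors = N.color
  weight : s.real weights = N.weight

/-- The arrays with the data of a net are not written. -/
def keepsNet (p : Block) : Bool :=
  p.keepsNat sizes && p.keepsNat ends₁ && p.keepsNat ends₂ && p.keepsNat bounds &&
    p.keepsNat colors && p.keepsReal weights

namespace Net.Loaded

variable {N : Net} {s s' : Mem} {p : Block}

theorem frame (h : N.Loaded s) (hf : p.Frame s s') (hp : keepsNet p = true := by rfl) :
    N.Loaded s' := by
  simp only [keepsNet, Bool.and_eq_true] at hp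
  obtain ⟨⟨⟨⟨⟨hsizes, hx⟩, hy⟩, hbound⟩, hcolor⟩, hweight⟩ := hp
  exact ⟨hf.nat _ hsizes ▸ h.n, hf.nat _ hsizes ▸ h.m, hf.nat _ hx ▸ h.x, hf.nat _ hy ▸ h.y,
    hf.nat _ hbound ▸ h.bound, hf.nat _ hcolor ▸ h.color, hf.real _ hweight ▸ h.weight⟩

theorem run (h : N.Loaded s) (p : Block) (hp : keepsNet p = true := by rfl) :
    N.Loaded (p.run s) :=
  h.frame (p.frame_run s) hp

end Net.Loaded

/-- The labels `f` of the vertices distinguish the components of the edges `S`. -/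
def Net.LabelsComponents (N : Net) (S : Finset ℕ) (f : ℕ → ℕ) : Prop :=
  ∀ u < N.n, ∀ v < N.n, f u = f v ↔ Linked N.x N.y S u v

namespace Net.LabelsComponents

variable {N : Net} {S : Finset ℕ} {f g : ℕ → ℕ} {j : ℕ}

theorem empty (h : ∀ u < N.n, f u = u) : N.LabelsComponents ∅ f := fun u hu v hv => by
  rw [h u hu, h v hv, Linked.empty_iff]

theorem linked_iff (h : N.LabelsComponents S f) (hj : j < N.m) :
    f (N.x j) = f (N.y j) ↔ Linked N.x N.y S (N.x j) (N.y j) :=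
  h _ (N.x_lt j hj) _ (N.y_lt j hj)

theorem insert (h : N.LabelsComponents S f) (hj : j < N.m)
    (hg : ∀ u < N.n, g u = if f u = f (N.x j) then f (N.y j) else f u) :
    N.LabelsComponents (insert j S) g := by
  intro u hu v hv
  have hx := N.x_lt j hj
  have hy := N.y_lt j hj
  rw [hg u hu, hg v hv, Linked.insert_iff, ← h u hu v hv, ← h u hu _ hx, ← h _ hy v hv,
    ← h u hu _ hy, ← h _ hx v hv]
  grind

end Net.LabelsComponents

/-- Replaces `oldLabel` by `newLabel`. -/
def relabel : Block :=
  forVertices vertex (.ite (.natEq (.get labels (.var vertex)) (.var oldLabel))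
    (.setNat labels (.var vertex) (.var newLabel)) .skip)

/-- Gives every vertex a label of its own. -/
def initLabels : Block := forVertices vertex (.setNat labels (.var vertex) (.var vertex))

/-- Merges the labels of the components of the two ends of `edge`. -/
def mergeLabels : Block :=
  .seq (.assign oldLabel (.get labels (.get ends₁ (.var edge)))) <|
  .seq (.assign newLabel (.get labels (.get ends₂ (.var edge)))) <|
  relabel

/-- Labels the vertices by the components of the marked edges. -/
def components : Block :=
  initLabels.seq <|
  forEdges edge (.ite (.natEq (.get marks (.var edge)) (.lit 1)) mergeLabels .skip)

theorem relabel_spec (s : Mem) {u : ℕ} (hu : u < s.nat sizes 0) : (relabel.run s).nat labels u =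
    if s.nat labels u = s.nat oldLabel 0 then s.nat newLabel 0 else s.nat labels u := by
  refine (Block.nat_loopTo_eq_ite rfl (by decide)
    (fun u => if s.nat labels u = s.nat oldLabel 0 then s.nat newLabel 0 else s.nat labels u)
    (fun i s' _ hc hf hi => ?_) u).trans (if_pos hu)
  have hold := hf.nat oldLabel rfl
  have hnew := hf.nat newLabel rfl
  by_cases hcond : s.nat labels i = s.nat oldLabel 0
  · rw [Block.run_ite_pos (by simp [NatExpr.eval, *])]
    simp [hc, hnew, hcond]
  · rw [Block.run_ite_neg (by simp [NatExpr.eval, *])]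
    rw [if_neg hcond, ← hi, Function.update_eq_self, Block.run_skip]

theorem initLabels_spec (s : Mem) {u : ℕ} (hu : u < s.nat sizes 0) :
    (initLabels.run s).nat labels u = u :=
  (Block.nat_loopTo_eq_ite rfl (by decide) id (fun i s' _ hc _ _ => by simp [hc]) u).trans
    (if_pos hu)

section Components

variable {N : Net} {s : Mem} {S : Finset ℕ}

theorem labelsComponents_mergeLabels (h : N.Loaded s) {j : ℕ} (hj : j < N.m)
    (hc : s.nat edge 0 = j) (hS : N.LabelsComponents S (s.nat labels)) :
    N.LabelsComponents (insert j S) ((mergeLabels.run s).nat labels) := by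
  refine hS.insert hj fun u hu => ?_
  rw [mergeLabels, Block.run_seq, Block.run_seq, relabel_spec _ (by simpa [h.n] using hu)]
  simp [NatExpr.eval, hc, h.x, h.y]

theorem labelsComponents_components (h : N.Loaded s) :
    N.LabelsComponents (N.marked (s.nat marks)) ((components.run s).nat labels) := by
  have hinit : N.LabelsComponents ∅ ((initLabels.run s).nat labels) :=
    .empty fun u hu => initLabels_spec s (by rwa [h.n])
  have hmarks := Block.nat_run initLabels s marks
  rw [components, Block.run_seq]
  have hL := h.run initLabels
  generalize initLabels.run s = s₁ at *
  have hloop := Block.loopTo_induction (v := edge) (k := 1) (d := 0) (s := s₁)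
    (p := .ite (.natEq (.get marks (.var edge)) (.lit 1)) mergeLabels .skip)
    (fun i s' => N.LabelsComponents ((Finset.range i).filter fun j => s.nat marks j = 1)
      (s'.nat labels)) rfl (fun _ _ _ h => by simpa using h) (by simpa using hinit) ?_
  · rwa [hL.m] at hloop
  · intro i s' hi hc hf hI
    rw [hL.m] at hi
    have hmark : s'.nat marks = s.nat marks := (hf.nat marks rfl).trans hmarks
    rw [Finset.range_add_one, Finset.filter_insert]
    split_ifs with hi1
    · rw [Block.run_ite_pos (by simp [NatExpr.eval, hc, hmark, hi1])]
      exact labelsComponents_mergeLabels (hL.frame hf) hi hc hI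
    · rwa [Block.run_ite_neg (by simp [NatExpr.eval, hc, hmark, hi1])]

/-- The edge `index` joins different components and is lighter than `lightest`. -/
def isLighter : Cond :=
  .and (.not (.natEq (.get labels (.get ends₁ (.var index)))
      (.get labels (.get ends₂ (.var index)))))
    (.or (.natEq (.var lightest) (.get sizes (.lit 1)))
      (.not (.realLe (.get weights (.var lightest)) (.get weights (.var index)))))

/-- Searches an edge of minimum weight between different components; the number of edges means that
there is none. -/
def findLightest : Block :=
  .seq (.assign lightest (.get sizes (.lit 1))) <|
  forEdges index (.ite isLighter (.assign lightest (.var index)) .skip)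

/-- Marks an edge of minimum weight between different components of the marked edges. -/
def addLightest : Block :=
  components.seq <| findLightest.seq <| .setNat marks (.var lightest) (.lit 1)

/-- Marks the edges of a minimum spanning tree, if there is a spanning tree. -/
def greedy : Block := .loopTo counter 0 1 addLightest

/-- Tests whether the marked edges connect all vertices. -/
def testConnected : Block :=
  components.seq <|
  .seq (.assign connected (.lit 1)) <|
  forVertices index (.ite (.natEq (.get labels (.var index)) (.get labels (.lit 0))) .skip
    (.assign connected (.lit 0)))

theorem isLighter_holds_iff (h : N.Loaded s) (hS : N.LabelsComponents S (s.nat labels)) {i : ℕ}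
    (hi : i < N.m) (hc : s.nat index 0 = i) {o : Option ℕ}
    (ho : s.nat lightest 0 = o.getD N.m ∧ ∀ q ∈ o, q < N.m) :
    isLighter.Holds s ↔
      ¬ Linked N.x N.y S (N.x i) (N.y i) ∧ ∀ q ∈ o, N.weight i < N.weight q := by
  rw [← hS.linked_iff hi]
  obtain ⟨ho, hom⟩ := ho
  cases o with
  | none => simp_all [isLighter, Cond.Holds, NatExpr.eval, h.x, h.y, h.m]
  | some q =>
    have hq := (hom q rfl).ne
    simp_all [isLighter, Cond.Holds, NatExpr.eval, RealExpr.eval, h.x, h.y, h.m, h.weight]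

theorem findLightest_spec (h : N.Loaded s) (hS : N.LabelsComponents S (s.nat labels)) :
    ∃ o, IsArgmin N.weight {j | j < N.m ∧ ¬ Linked N.x N.y S (N.x j) (N.y j)} o ∧
      (findLightest.run s).nat lightest 0 = o.getD N.m := by
  have hL := h.run (.assign lightest (.get sizes (.lit 1)))
  have hlabels := Block.nat_run (.assign lightest (.get sizes (.lit 1))) s labels
  have hm : ((Block.assign lightest (.get sizes (.lit 1))).run s).nat lightest 0 = N.m := by
    simp [NatExpr.eval, h.m]
  rw [findLightest, Block.run_seq]
  generalize (Block.assign lightest (.get sizes (.lit 1))).run s = s₁ at *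
  obtain ⟨o, ho, hmin⟩ := Block.loopTo_isArgmin (v := index) (k := 1) (d := 0) (s := s₁)
    (p := .ite isLighter (.assign lightest (.var index)) .skip) (key := N.weight) (Q := ∅)
    (fun s' o => s'.nat lightest 0 = o.getD N.m ∧ ∀ q ∈ o, q < N.m) id
    (fun j => ¬ Linked N.x N.y S (N.x j) (N.y j)) rfl (fun s' o x h => by simpa using h)
    (o := none) (by simpa using hm) rfl (by
      intro i s' o hi hc hf ho
      rw [hL.m] at hi
      have hholds := isLighter_holds_iff (hL.frame hf)
        (by rwa [hf.nat labels rfl, hlabels]) hi hc ho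
      by_cases hcond : isLighter.Holds s'
      · rw [Block.run_ite_pos hcond, id, if_pos (hholds.1 hcond)]
        simpa [hc] using hi
      · rwa [Block.run_ite_neg hcond, id, if_neg (mt hholds.2 hcond)])
  refine ⟨o, ?_, ho.1⟩
  simpa [hL.m] using hmin

theorem addLightest_spec (h : N.Loaded s) :
    ∃ o, IsArgmin N.weight
        {j | j < N.m ∧ ¬ Linked N.x N.y (N.marked (s.nat marks)) (N.x j) (N.y j)} o ∧
      N.marked ((addLightest.run s).nat marks) = o.toFinset ∪ N.marked (s.nat marks) := by
  obtain ⟨o, hmin, ho⟩ := findLightest_spec (h.run components) (labelsComponents_components h)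
  refine ⟨o, hmin, ?_⟩
  have hmarks := (Block.nat_run findLightest _ marks).trans (Block.nat_run components s marks)
  rw [addLightest, Block.run_seq, Block.run_seq, Block.run_setNat, NatExpr.eval_var, ho,
    Mem.nat_writeNat, if_pos rfl, hmarks]
  cases o with
  | none =>
    ext j
    simpa [Net.mem_marked] using fun hj => by simp [hj.ne]
  | some q => exact Net.marked_update_one hmin.1.1

/-- The invariant of Kruskal's algorithm after `i` steps. If there is no spanning tree, then only
the number of edges is controlled. -/
def Net.IsGreedy (N : Net) (i : ℕ) (T : Finset ℕ) : Prop :=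
  T.card ≤ i ∧ ((∃ S, N.bases.IsBase S) →
    T.card = i ∧ ∃ S, MinWeight N.bases.IsBase N.weight S ∧ T ⊆ S)

theorem Net.isGreedy_empty (N : Net) : N.IsGreedy 0 ∅ := by
  refine ⟨le_rfl, fun ⟨S, hS⟩ => ⟨rfl, ?_⟩⟩
  obtain ⟨T, hT⟩ := exists_minWeight (fun _ => N.bases.subset_ground) hS N.weight
  exact ⟨T, hT, Finset.empty_subset T⟩

theorem Net.IsGreedy.succ {i : ℕ} (h : N.IsGreedy i S) (hi : i < N.n - 1) {o : Option ℕ}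
    (ho : IsArgmin N.weight {j | j < N.m ∧ ¬ Linked N.x N.y S (N.x j) (N.y j)} o) :
    N.IsGreedy (i + 1) (o.toFinset ∪ S) := by
  obtain ⟨hle, h⟩ := h
  cases o with
  | none =>
    refine ⟨by simpa using hle.trans i.le_succ, fun hB => ?_⟩
    obtain ⟨hcard, B, hB, -⟩ := h hB
    have hBcard := hB.1.card_add_one
    rw [Finset.card_range] at hBcard
    obtain ⟨j, hj, hjS⟩ := hB.1.exists_not_linked_of_card_lt (hcard.trans_lt (by lia))
    exact absurd ⟨Finset.mem_range.1 (hB.1.subset hj), hjS⟩ (Set.eq_empty_iff_forall_notMem.1 ho j)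
  | some f =>
    obtain ⟨⟨hf, hfS⟩, hmin⟩ := ho
    have hfS' : f ∉ S := fun hmem => hfS (.of_mem hmem)
    have hcard : (insert f S).card = S.card + 1 := Finset.card_insert_of_notMem hfS'
    refine ⟨hcard.trans_le (Nat.succ_le_succ hle), fun hB => ?_⟩
    obtain ⟨hSi, B, hB, hSB⟩ := h hB
    exact ⟨by rw [← hSi]; exact hcard, hB.exists_insert_subset hSB (Finset.mem_range.2 hf)
      (Finset.mem_range.2 (N.x_lt f hf)) (Finset.mem_range.2 (N.y_lt f hf)) hfS
      fun j hj hjS => isMinOn_iff.1 hmin j ⟨Finset.mem_range.1 hj, hjS⟩⟩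

theorem Net.IsGreedy.minWeight (h : N.IsGreedy (N.n - 1) S) {B : Finset ℕ}
    (hB : N.bases.IsBase B) : MinWeight N.bases.IsBase N.weight S := by
  obtain ⟨hcard, B, hB, hSB⟩ := h.2 ⟨B, hB⟩
  have hBcard := hB.1.card_add_one
  rw [Finset.card_range] at hBcard
  rwa [Finset.eq_of_subset_of_card_le hSB (by lia)]

theorem Net.IsGreedy.isBase_iff (h : N.IsGreedy (N.n - 1) S) (hn : 0 < N.n)
    (hS : S ⊆ .range N.m) :
    N.bases.IsBase S ↔ ∀ u < N.n, ∀ v < N.n, Linked N.x N.y S u v := by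
  refine ⟨fun hB u hu v hv => hB.linked u (by simpa) v (by simpa), fun hlinked => ?_⟩
  have hcard := h.1
  exact .of_linked hS (by rw [Finset.card_range]; lia) (by simpa using hlinked)

theorem isGreedy_greedy (h : N.Loaded s) (hmarks : N.marked (s.nat marks) = ∅) :
    N.IsGreedy (N.n - 1) (N.marked ((greedy.run s).nat marks)) := by
  rw [← h.n]
  refine Block.loopTo_induction (fun i s' => N.IsGreedy i (N.marked (s'.nat marks))) rfl
    (fun _ _ _ h => by simpa using h) (by simpa [hmarks] using N.isGreedy_empty)
    fun i s' hi _ hf hI => ?_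
  obtain ⟨o, ho, heq⟩ := addLightest_spec (h.frame hf)
  rw [heq]
  exact hI.succ (by rwa [← h.n]) ho

theorem testConnected_spec (h : N.Loaded s) (hn : 0 < N.n) :
    (testConnected.run s).nat connected 0 = 1 ↔
      ∀ u < N.n, ∀ v < N.n, Linked N.x N.y (N.marked (s.nat marks)) u v := by
  have hlabels := labelsComponents_components h
  have hL := h.run components
  rw [testConnected, Block.run_seq, Block.run_seq]
  generalize components.run s = s₁ at *
  have hloop := Block.loopTo_induction (s := (Block.assign connected (.lit 1)).run s₁) (v := index)
    (k := 0) (d := 0) (p := .ite (.natEq (.get labels (.var index)) (.get labels (.lit 0))) .skip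
      (.assign connected (.lit 0)))
    (fun i s' => s'.nat connected 0 = 1 ↔ ∀ u < i, s₁.nat labels u = s₁.nat labels 0)
    rfl (fun _ _ _ h => by simpa using h) (by simp [NatExpr.eval]) (fun i s' _ hc hf hI => ?_)
  · refine hloop.trans ⟨fun hall u hu v hv => ?_, fun hall u hu => ?_⟩
    · rw [← hlabels u hu v hv]
      rw [(hL.run (.assign connected (.lit 1))).n] at hall
      exact (hall u hu).trans (hall v hv).symm
    · rw [(hL.run (.assign connected (.lit 1))).n] at hu
      exact (hlabels u hu 0 hn).2 (hall u hu 0 hn)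
  · have hlab : s'.nat labels = s₁.nat labels := hf.nat labels rfl
    rw [Nat.forall_lt_succ_right]
    by_cases hcond : s₁.nat labels i = s₁.nat labels 0
    · rw [Block.run_ite_pos (by simp [NatExpr.eval, hc, hlab, hcond]), Block.run_skip, hI]
      simp [hcond]
    · rw [Block.run_ite_neg (by simp [NatExpr.eval, hc, hlab, hcond])]
      simp [NatExpr.eval, hcond]

end Components

/-! ### The search on the machine -/

/-- The gap of the exchange of `edgeOut` for `edgeIn`. -/
def exchangeGap : RealExpr :=
  .sub (.add (.get weights (.var edgeIn)) (.get penalties (.get colors (.var edgeIn))))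
    (.add (.get weights (.var edgeOut)) (.get penalties (.get colors (.var edgeOut))))

/-- The exchange of `edgeOut` for `edgeIn` is a candidate with a smaller key than the exchange of
`bestOut` for `bestIn`. Here `bestOut` is the number of edges as long as there is no candidate. -/
def isBetter : Cond :=
  .and
    (.and (.not (.natEq (.get labels (.get ends₁ (.var edgeIn)))
        (.get labels (.get ends₂ (.var edgeIn)))))
      (.natLe (.lit 1) (.get ranks (.get colors (.var edgeIn)))))
    (.or (.natEq (.var bestOut) (.get sizes (.lit 1)))
      (.and (.realLe exchangeGap (.get bestGap (.lit 0)))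
        (.or (.not (.realLe (.get bestGap (.lit 0)) exchangeGap))
          (.not (.natLe (.get ranks (.get colors (.var bestIn)))
            (.get ranks (.get colors (.var edgeIn))))))))

/-- Makes the exchange of `edgeOut` for `edgeIn` the best one. -/
def storeBest : Block :=
  .seq (.assign bestOut (.var edgeOut)) <|
  .seq (.assign bestIn (.var edgeIn)) <|
  .setReal bestGap (.lit 0) exchangeGap

/-- Compares the candidates that remove `edgeOut` with the best exchange, where the labels are those
of the components without `edgeOut`. -/
def scanInsertions : Block := forEdges edgeIn (.ite isBetter storeBest .skip)

/-- Labels the vertices by the components of the marked edges without the marked edge `edgeOut`. -/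
def splitComponents : Block :=
  .seq (.setNat marks (.var edgeOut) (.lit 0)) <|
  components.seq <|
  .setNat marks (.var edgeOut) (.lit 1)

/-- Compares the candidates that remove `edgeOut` with the best exchange. -/
def scanEdge : Block :=
  .ite (.and (.natEq (.get marks (.var edgeOut)) (.lit 1))
      (.natEq (.get ranks (.get colors (.var edgeOut))) (.lit 0)))
    (splitComponents.seq scanInsertions) .skip

/-- Searches a candidate with the smallest key. -/
def scan : Block := .seq (.assign bestOut (.get sizes (.lit 1))) <| forEdges edgeOut scanEdge

/-- The exchange `o` is stored in the memory `s`. -/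
def Net.HoldsBest (N : Net) (s : Mem) : Option (ℕ × ℕ) → Prop
  | none => s.nat bestOut 0 = N.m
  | some p => p.1 < N.m ∧ s.nat bestOut 0 = p.1 ∧ s.nat bestIn 0 = p.2 ∧
      s.real bestGap 0 = N.bases.gap (s.real penalties) p.1 p.2

section Scan

variable {N : Net} {s s' : Mem} {T : Finset ℕ} {o : Option (ℕ × ℕ)} {e f : ℕ} {rank : ℕ → ℕ}

theorem Net.HoldsBest.congr (h : N.HoldsBest s o) (hout : s'.nat bestOut 0 = s.nat bestOut 0)
    (hin : s'.nat bestIn 0 = s.nat bestIn 0) (hgap : s'.real bestGap = s.real bestGap)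
    (hpen : s'.real penalties = s.real penalties) : N.HoldsBest s' o := by
  cases o <;> simpa only [Net.HoldsBest, hout, hin, hgap, hpen] using h

theorem exchangeGap_eval (h : N.Loaded s) (he : s.nat edgeOut 0 = e) (hf : s.nat edgeIn 0 = f) :
    exchangeGap.eval s = N.bases.gap (s.real penalties) e f := by
  simp [exchangeGap, RealExpr.eval, NatExpr.eval, h.weight, h.color, he, hf, ColoredBases.gap,
    ColoredBases.penalized, Net.bases]

theorem isBetter_holds_iff (h : N.Loaded s) (hS : N.LabelsComponents T (s.nat labels))
    (hfm : f < N.m) (he : s.nat edgeOut 0 = e) (hf : s.nat edgeIn 0 = f)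
    (ho : N.HoldsBest s o) :
    isBetter.Holds s ↔
      (¬ Linked N.x N.y T (N.x f) (N.y f) ∧ 1 ≤ s.nat ranks (N.color f)) ∧
        ∀ q ∈ o, N.bases.key (s.real penalties) (s.nat ranks) (e, f) <
          N.bases.key (s.real penalties) (s.nat ranks) q := by
  rw [← hS.linked_iff hfm]
  simp only [isBetter, Cond.Holds, Cond.holds_or, Cond.holds_natEq, RealExpr.eval, NatExpr.eval,
    NatExpr.eval_var, exchangeGap_eval h he hf, hf, h.x, h.y, h.color, h.m, not_le]
  refine and_congr_right fun _ => ?_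
  cases o with
  | none => simpa using .inl ho
  | some q =>
    obtain ⟨hq, hout, hin, hgap⟩ := ho
    simp only [hout, hin, hgap, hq.ne, false_or, Option.mem_some_iff, forall_eq',
      ColoredBases.key, Prod.Lex.toLex_lt_toLex]
    grind [Net.bases]

theorem holdsBest_storeBest (h : N.Loaded s) (hem : e < N.m) (he : s.nat edgeOut 0 = e)
    (hf : s.nat edgeIn 0 = f) : N.HoldsBest (storeBest.run s) (some (e, f)) := by
  have hgap := exchangeGap_eval (h.run (.seq (.assign bestOut (.var edgeOut))
    (.assign bestIn (.var edgeIn)))) (e := e) (f := f) (by simpa using he) (by simpa using hf)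
  refine ⟨hem, ?_, ?_, ?_⟩
  · simp [storeBest, he]
  · simp [storeBest, hf]
  · simpa [storeBest, NatExpr.eval] using hgap

theorem Net.mk_mem_candidates_iff (hT : N.bases.IsBase T) (heT : e ∈ T)
    (hrank : rank (N.color e) = 0) :
    (e, f) ∈ N.bases.candidates T rank ↔
      f < N.m ∧ ¬ Linked N.x N.y (T.erase e) (N.x f) (N.y f) ∧ 1 ≤ rank (N.color f) := by
  refine ⟨fun ⟨hex, _, hf⟩ => ⟨Finset.mem_range.1 hex.mem_ground,
    hT.not_linked_of_insert_erase heT hex.isBase, hf⟩, fun ⟨hfm, hlinked, hf⟩ =>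
    ⟨⟨heT, hT.insert_erase_of_not_linked heT (Finset.mem_range.2 hfm)
      (Finset.mem_range.2 (N.x_lt f hfm)) (Finset.mem_range.2 (N.y_lt f hfm)) hlinked⟩,
      hrank, hf⟩⟩

theorem Net.candidates_lt_succ (hT : N.bases.IsBase T) :
    {p ∈ N.bases.candidates T rank | p.1 < e + 1} = {p ∈ N.bases.candidates T rank | p.1 < e} ∪
      if e ∈ T ∧ rank (N.color e) = 0 then {q | ∃ f < N.m,
        (¬ Linked N.x N.y (T.erase e) (N.x f) (N.y f) ∧ 1 ≤ rank (N.color f)) ∧ q = (e, f)}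
      else ∅ := by
  ext ⟨a, b⟩
  simp only [Set.mem_ofPred_eq, Set.mem_union, Nat.lt_succ_iff_lt_or_eq, and_or_left]
  refine or_congr_right ⟨?_, ?_⟩
  · rintro ⟨hab, rfl⟩
    rw [if_pos ⟨hab.1.mem, hab.2.1⟩]
    obtain ⟨hb, hlinked, hpos⟩ := (mk_mem_candidates_iff hT hab.1.mem hab.2.1).1 hab
    exact ⟨b, hb, ⟨hlinked, hpos⟩, rfl⟩
  · split_ifs with he
    · rintro ⟨f, hf, ⟨hlinked, hpos⟩, hab⟩
      obtain ⟨rfl, rfl⟩ := Prod.mk.inj hab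
      exact ⟨(mk_mem_candidates_iff hT he.1 he.2).2 ⟨hf, hlinked, hpos⟩, rfl⟩
    · exact False.elim

theorem scanInsertions_spec (h : N.Loaded s) (hS : N.LabelsComponents T (s.nat labels))
    (hem : e < N.m) (he : s.nat edgeOut 0 = e) {Q : Set (ℕ × ℕ)} (ho : N.HoldsBest s o)
    (hmin : IsArgmin (N.bases.key (s.real penalties) (s.nat ranks)) Q o) :
    ∃ o, N.HoldsBest (scanInsertions.run s) o ∧
      IsArgmin (N.bases.key (s.real penalties) (s.nat ranks)) (Q ∪ {q | ∃ f < N.m,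
        (¬ Linked N.x N.y T (N.x f) (N.y f) ∧ 1 ≤ s.nat ranks (N.color f)) ∧ q = (e, f)}) o := by
  have hloop := Block.loopTo_isArgmin (v := edgeIn) (k := 1) (d := 0) N.HoldsBest (fun f => (e, f))
    (fun f => ¬ Linked N.x N.y T (N.x f) (N.y f) ∧ 1 ≤ s.nat ranks (N.color f)) rfl
    (fun s' o x h => h.congr (by simp) (by simp) rfl rfl) ho hmin
    (p := .ite isBetter storeBest .skip) (fun f s' o hf hc hfr ho => ?_)
  · rwa [h.m] at hloop
  · rw [h.m] at hf
    have hedge : s'.nat edgeOut 0 = e := by rw [hfr.nat edgeOut rfl, he]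
    have hL := h.frame hfr
    rw [← hfr.real penalties rfl, ← hfr.nat ranks rfl]
    have hholds := isBetter_holds_iff hL (by rwa [hfr.nat labels rfl]) hf hedge hc ho
    by_cases hcond : isBetter.Holds s'
    · rw [Block.run_ite_pos hcond, if_pos (hholds.1 hcond)]
      exact holdsBest_storeBest hL hem hedge hc
    · rwa [Block.run_ite_neg hcond, if_neg (mt hholds.2 hcond)]

theorem labelsComponents_splitComponents (h : N.Loaded s) (he : s.nat edgeOut 0 = e) :
    N.LabelsComponents ((N.marked (s.nat marks)).erase e) ((splitComponents.run s).nat labels) := by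
  have hcomp := labelsComponents_components (h.run (.setNat marks (.var edgeOut) (.lit 0)))
  simpa [splitComponents, NatExpr.eval, he, Net.marked_update_zero] using hcomp

theorem marks_splitComponents (he : s.nat edgeOut 0 = e) (hmark : s.nat marks e = 1) :
    (splitComponents.run s).nat marks = s.nat marks := by
  simp [splitComponents, NatExpr.eval, he, Block.nat_run components _ edgeOut,
    Block.nat_run components _ marks, hmark]

theorem scanEdge_spec (h : N.Loaded s) (hT : N.bases.IsBase (N.marked (s.nat marks)))
    (hem : e < N.m) (he : s.nat edgeOut 0 = e) (ho : N.HoldsBest s o)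
    (hmin : IsArgmin (N.bases.key (s.real penalties) (s.nat ranks))
      {p ∈ N.bases.candidates (N.marked (s.nat marks)) (s.nat ranks) | p.1 < e} o) :
    (scanEdge.run s).nat marks = s.nat marks ∧ ∃ o, N.HoldsBest (scanEdge.run s) o ∧
      IsArgmin (N.bases.key (s.real penalties) (s.nat ranks))
        {p ∈ N.bases.candidates (N.marked (s.nat marks)) (s.nat ranks) | p.1 < e + 1} o := by
  have hcond : (Cond.and (.natEq (.get marks (.var edgeOut)) (.lit 1))
      (.natEq (.get ranks (.get colors (.var edgeOut))) (.lit 0))).Holds s ↔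
      e ∈ N.marked (s.nat marks) ∧ s.nat ranks (N.color e) = 0 := by
    simp [Cond.Holds, NatExpr.eval, he, h.color, Net.mem_marked, hem]
  by_cases hrem : e ∈ N.marked (s.nat marks) ∧ s.nat ranks (N.color e) = 0
  · rw [scanEdge, Block.run_ite_pos (hcond.2 hrem), Block.run_seq, Net.candidates_lt_succ hT,
      if_pos hrem, Block.nat_run scanInsertions _ marks,
      marks_splitComponents he (Net.mem_marked.1 hrem.1).2]
    have hL := h.run splitComponents
    have hlabels := labelsComponents_splitComponents h he
    have hf := splitComponents.frame_run s
    generalize splitComponents.run s = s₁ at *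
    rw [← hf.real penalties rfl, ← hf.nat ranks rfl] at hmin ⊢
    exact ⟨rfl, scanInsertions_spec hL hlabels hem ((congrFun (hf.nat edgeOut rfl) 0).trans he)
      (ho.congr (congrFun (hf.nat bestOut rfl) 0) (congrFun (hf.nat bestIn rfl) 0)
        (hf.real bestGap rfl) (hf.real penalties rfl)) hmin⟩
  · rw [scanEdge, Block.run_ite_neg (mt hcond.1 hrem), Net.candidates_lt_succ hT, if_neg hrem,
      Set.union_empty]
    exact ⟨rfl, o, ho, hmin⟩

theorem scan_spec (h : N.Loaded s) (hT : N.bases.IsBase (N.marked (s.nat marks))) :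
    (scan.run s).nat marks = s.nat marks ∧ ∃ o, N.HoldsBest (scan.run s) o ∧
      IsArgmin (N.bases.key (s.real penalties) (s.nat ranks))
        (N.bases.candidates (N.marked (s.nat marks)) (s.nat ranks)) o := by
  have hbest : N.HoldsBest ((Block.assign bestOut (.get sizes (.lit 1))).run s) none := by
    simp [Net.HoldsBest, NatExpr.eval, h.m]
  have hL := h.run (.assign bestOut (.get sizes (.lit 1)))
  rw [← Block.nat_run (.assign bestOut (.get sizes (.lit 1))) s marks] at hT ⊢
  rw [← Block.nat_run (.assign bestOut (.get sizes (.lit 1))) s ranks,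
    ← Block.real_run (.assign bestOut (.get sizes (.lit 1))) s penalties, scan, Block.run_seq]
  generalize (Block.assign bestOut (.get sizes (.lit 1))).run s = s₁ at *
  have hloop := Block.loopTo_induction (s := s₁) (v := edgeOut) (k := 1) (d := 0) (p := scanEdge)
    (fun e s' => s'.nat marks = s₁.nat marks ∧ ∃ o, N.HoldsBest s' o ∧
      IsArgmin (N.bases.key (s₁.real penalties) (s₁.nat ranks))
        {p ∈ N.bases.candidates (N.marked (s₁.nat marks)) (s₁.nat ranks) | p.1 < e} o) rfl
    (fun e s' x ⟨hmarks, o, ho, hmin⟩ => ⟨by simpa using hmarks, o,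
      ho.congr (by simp) (by simp) rfl rfl, hmin⟩)
    ⟨rfl, none, hbest, by simp [IsArgmin]⟩ (fun e s' he hc hf ⟨hmarks, o, ho, hmin⟩ => ?_)
  · obtain ⟨hmarks, o, ho, hmin⟩ := hloop
    refine ⟨hmarks, o, ho, ?_⟩
    rwa [Set.sep_eq_self_iff_mem_true.2 fun p hp => ?_] at hmin
    rw [hL.m]
    exact Finset.mem_range.1 (hT.subset hp.1.mem)
  · rw [hL.m] at he
    rw [← hmarks] at hT hmin ⊢
    rw [← hf.real penalties rfl, ← hf.nat ranks rfl] at hmin ⊢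
    exact scanEdge_spec (hL.frame hf) hT he hc ho hmin

end Scan

/-- Raises the penalties of the unreached colours by the gap of the best exchange. -/
def raisePenalties : Block :=
  forEdges index (.ite (.natEq (.get ranks (.var index)) (.lit 0))
    (.setReal penalties (.var index) (.add (.get penalties (.var index)) (.get bestGap (.lit 0))))
    .skip)

/-- Makes the best exchange the exit of the colour of the removed edge. -/
def reachColor : Block :=
  raisePenalties.seq <|
  .seq (.setNat ranks (.get colors (.var bestOut)) (.add (.var searchRound) (.lit 2))) <|
  .seq (.setNat outs (.get colors (.var bestOut)) (.var bestOut)) <|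
  .setNat inns (.get colors (.var bestOut)) (.var bestIn)

/-- A round of the search for colours from which a path leads to a colour that is not used up. -/
def searchStep : Block :=
  scan.seq <| .ite (.natEq (.var bestOut) (.get sizes (.lit 1))) .skip reachColor

/-- The search; every round reaches a new colour or finds that there is none. -/
def search : Block := .loopTo searchRound 1 0 searchStep

/-- The memory holds the state of the search for the tree `T` after `r` rounds. -/
def Net.HoldsSearch (N : Net) (T : Finset ℕ) (s : Mem) (r : ℕ) : Prop :=
  N.bases.Search T (s.real penalties) (s.nat ranks) (s.nat outs) (s.nat inns) r

section Search

variable {N : Net} {s s' : Mem} {T : Finset ℕ} {r : ℕ}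

theorem raisePenalties_spec (h : N.Loaded s) : (raisePenalties.run s).real penalties =
    N.bases.raise (s.nat ranks) (s.real bestGap 0) (s.real penalties) := by
  have hloop := Block.loopTo_induction (s := s) (v := index) (k := 1) (d := 0)
    (p := .ite (.natEq (.get ranks (.var index)) (.lit 0)) (.setReal penalties (.var index)
      (.add (.get penalties (.var index)) (.get bestGap (.lit 0)))) .skip)
    (fun i s' => ∀ c, s'.real penalties c = if c < i ∧ s.nat ranks c = 0 then
      s.real penalties c + s.real bestGap 0 else s.real penalties c) rfl
    (fun _ _ _ h => by simpa using h) (by simp) (fun i s' hi hc hf hI c => ?_)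
  · ext c
    simpa [raisePenalties, h.m, ColoredBases.raise, Net.bases] using hloop c
  · have hrank : s'.nat ranks = s.nat ranks := hf.nat ranks rfl
    have hgap : s'.real bestGap = s.real bestGap := hf.real bestGap rfl
    by_cases hcond : s.nat ranks i = 0
    · rw [Block.run_ite_pos (by simp [NatExpr.eval, hc, hrank, hcond])]
      rcases eq_or_ne c i with rfl | hne
      · simp [NatExpr.eval, RealExpr.eval, hc, hgap, hI c, hcond]
      · simp [hc, hne, hne.le_iff_lt, hI c]
    · rw [Block.run_ite_neg (by simp [NatExpr.eval, hc, hrank, hcond]), Block.run_skip, hI c]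
      grind

theorem holdsSearch_reachColor (h : N.Loaded s) (hs : N.HoldsSearch T s r)
    (hr : s.nat searchRound 0 = r) {p : ℕ × ℕ} (hp : N.HoldsBest s (some p))
    (hmin : IsArgmin (N.bases.key (s.real penalties) (s.nat ranks))
      (N.bases.candidates T (s.nat ranks)) (some p)) :
    N.HoldsSearch T (reachColor.run s) (r + 1) := by
  have hnext := hs.succ_of_isMinOn hmin.1 hmin.2
  obtain ⟨-, hout, hin, hgap⟩ := hp
  have hraise := raisePenalties_spec h
  have hf := raisePenalties.frame_run s
  rw [← hgap, ← hraise] at hnext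
  have hranks := hf.nat ranks rfl
  have houts := hf.nat outs rfl
  have hinns := hf.nat inns rfl
  have hcolors := (hf.nat colors rfl).trans h.color
  simp only [Net.HoldsSearch, reachColor, Block.run_seq]
  generalize raisePenalties.run s = s₁ at *
  have hcolor : N.bases.color = N.color := rfl
  rw [hcolor] at hnext
  simpa [NatExpr.eval, hcolors, houts, hinns, hranks, hf.nat bestOut rfl, hf.nat bestIn rfl,
    hf.nat searchRound rfl, hout, hin, hr] using hnext

theorem searchStep_spec (h : N.Loaded s) (hs : N.HoldsSearch (N.marked (s.nat marks)) s r)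
    (hr : s.nat searchRound 0 = r) :
    (searchStep.run s).nat marks = s.nat marks ∧
      N.HoldsSearch (N.marked (s.nat marks)) (searchStep.run s) (r + 1) := by
  obtain ⟨hmarks, o, ho, hmin⟩ := scan_spec h hs.isDual.isMinBase.1
  have hf := scan.frame_run s
  have hL := h.run scan
  rw [searchStep, Block.run_seq]
  generalize scan.run s = s₁ at *
  have hs₁ : N.HoldsSearch (N.marked (s.nat marks)) s₁ r := by
    rwa [Net.HoldsSearch, hf.real penalties rfl, hf.nat ranks rfl, hf.nat outs rfl,
      hf.nat inns rfl]
  rw [← hf.real penalties rfl, ← hf.nat ranks rfl] at hmin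
  cases o with
  | none =>
    have ho : s₁.nat bestOut 0 = N.m := ho
    rw [Block.run_ite_pos (by simp [NatExpr.eval, hL.m, ho])]
    exact ⟨hmarks, hs₁.succ_of_eq_empty hmin⟩
  | some p =>
    rw [Block.run_ite_neg (by simp [NatExpr.eval, hL.m, ho.2.1, ho.1.ne])]
    exact ⟨(Block.nat_run reachColor _ marks).trans hmarks, holdsSearch_reachColor hL hs₁
      ((congrFun (hf.nat searchRound rfl) 0).trans hr) ho hmin⟩

theorem search_spec (h : N.Loaded s) (hs : N.HoldsSearch (N.marked (s.nat marks)) s 0) :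
    (search.run s).nat marks = s.nat marks ∧
      N.HoldsSearch (N.marked (s.nat marks)) (search.run s) N.m := by
  have hloop := Block.loopTo_induction (s := s) (v := searchRound) (k := 1) (d := 0)
    (p := searchStep) (fun r s' => s'.nat marks = s.nat marks ∧
      N.HoldsSearch (N.marked (s.nat marks)) s' r) rfl
    (fun _ _ _ h => by simpa [Net.HoldsSearch] using h) ⟨rfl, hs⟩
    (fun r s' _ hc hf ⟨hmarks, hI⟩ => ?_)
  · rwa [h.m] at hloop
  · rw [← hmarks] at hI ⊢
    exact searchStep_spec (h.frame hf) hI hc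

end Search

/-! ### The complete algorithm on nets -/

/-- Counts the marked edges of every colour. -/
def countColors : Block :=
  .seq (forEdges index (.setNat counts (.var index) (.lit 0))) <|
  forEdges index (.ite (.natEq (.get marks (.var index)) (.lit 1))
    (.setNat counts (.get colors (.var index))
      (.add (.get counts (.get colors (.var index))) (.lit 1))) .skip)

/-- The numbers of edges of `S` of each colour are in the array `counts`. -/
def Net.HoldsCounts (N : Net) (S : Finset ℕ) (s : Mem) : Prop :=
  ∀ c < N.m, s.nat counts c = N.bases.count c S

/-- The colour `index` is used more often than its bound permits. -/
def isOver : Cond :=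
  .natLe (.add (.get bounds (.var index)) (.lit 2)) (.get counts (.var index))

/-- Gives rank `1` to the colours that are not used up, and rank `0` to the other ones. -/
def initSearch : Block :=
  forEdges index (.ite (.natLe (.get counts (.var index)) (.get bounds (.var index)))
    (.setNat ranks (.var index) (.lit 1)) (.setNat ranks (.var index) (.lit 0)))

/-- Searches exits for the marked tree. -/
def findExits : Block := countColors.seq <| initSearch.seq search

/-- Chooses a reached colour that is used too often; the number of edges means that there is
none. -/
def chooseColor : Block :=
  .seq (.assign chosenColor (.get sizes (.lit 1))) <|
  forEdges index (.ite (.and isOver (.natLe (.lit 1) (.get ranks (.var index))))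
    (.assign chosenColor (.var index)) .skip)

/-- Performs the exchange of the exit of `chosenColor` and moves on to the colour reached by it. -/
def useExit : Block :=
  .seq (.setNat marks (.get outs (.var chosenColor)) (.lit 0)) <|
  .seq (.setNat marks (.get inns (.var chosenColor)) (.lit 1)) <|
  .assign chosenColor (.get colors (.get inns (.var chosenColor)))

/-- Performs the exchanges on the path of exits from `chosenColor`. -/
def followExits : Block :=
  forEdges index (.ite (.natLe (.lit 2) (.get ranks (.var chosenColor))) useExit .skip)

/-- Decreases the excess of the marked tree, if this is possible. -/
def improve : Block :=
  findExits.seq <| chooseColor.seq <|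
  .ite (.natEq (.var chosenColor) (.get sizes (.lit 1))) .skip followExits

/-- Repeats `improve` often enough, since the excess of a tree is at most its number of edges. -/
def improveAll : Block := forVertices improveRound improve

/-- Answers whether the marked tree is within the bounds. -/
def verdict : Block :=
  countColors.seq <| .seq (.assign answer (.lit 1)) <|
  forEdges index (.ite isOver (.assign answer (.lit 0)) .skip)

/-- Marks a feasible tree of minimum weight and answers `1`, or answers `0`. -/
def solveNet : Block :=
  greedy.seq <| testConnected.seq <|
  .ite (.and (.natLe (.lit 1) (.get sizes (.lit 0))) (.natEq (.var connected) (.lit 1)))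
    (improveAll.seq verdict) .skip

section Solve

variable {N : Net} {s : Mem} {T : Finset ℕ} {c : ℕ}

theorem holdsCounts_countColors (h : N.Loaded s) :
    N.HoldsCounts (N.marked (s.nat marks)) (countColors.run s) := by
  have hzero (c : ℕ) := Block.nat_loopTo_eq_ite (s := s) (v := index) (k := 1) (d := 0)
    (a := counts) (p := .setNat counts (.var index) (.lit 0)) rfl (by decide) (fun _ => 0)
    (fun i s' _ hc _ _ => by simp [NatExpr.eval, hc]) c
  have hL := h.run (forEdges index (.setNat counts (.var index) (.lit 0)))
  have hmarks := Block.nat_run (forEdges index (.setNat counts (.var index) (.lit 0))) s marks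
  rw [countColors, Block.run_seq]
  generalize (forEdges index (.setNat counts (.var index) (.lit 0))).run s = s₁ at *
  have hloop := Block.loopTo_induction (s := s₁) (v := index) (k := 1) (d := 0)
    (p := .ite (.natEq (.get marks (.var index)) (.lit 1))
      (.setNat counts (.get colors (.var index))
        (.add (.get counts (.get colors (.var index))) (.lit 1))) .skip)
    (fun i s' => N.HoldsCounts ((Finset.range i).filter fun j => s.nat marks j = 1) s')
    rfl (fun _ _ _ h => by simpa [Net.HoldsCounts] using h)
    (fun c hc => by simp [hzero, h.m, hc, ColoredBases.count]) (fun i s' _ hc hf hI c hcm => ?_)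
  · rwa [hL.m] at hloop
  · have hmark : s'.nat marks = s.nat marks := (hf.nat marks rfl).trans hmarks
    rw [Finset.range_add_one, Finset.filter_insert]
    split_ifs with hi1
    · rw [Block.run_ite_pos (by simp [NatExpr.eval, hc, hmark, hi1]),
        ColoredBases.count_insert (by simp), ← hI c hcm]
      have hcolor : N.bases.color i = N.color i := rfl
      by_cases hci : c = N.color i <;> simp [NatExpr.eval, hc, (hL.frame hf).color, hcolor, hci]
    · rw [Block.run_ite_neg (by simp [NatExpr.eval, hc, hmark, hi1])]
      exact hI c hcm

theorem isOver_holds_iff (h : N.Loaded s) (hcounts : N.HoldsCounts T s) (hc : c < N.m)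
    (hi : s.nat index 0 = c) : isOver.Holds s ↔ N.bases.cap c < N.bases.count c T := by
  simp only [isOver, Cond.Holds, NatExpr.eval, NatExpr.eval_var, hi, h.bound, hcounts c hc]
  rfl

theorem initSearch_spec (h : N.Loaded s) (hcounts : N.HoldsCounts T s) (hc : c < N.m) :
    (initSearch.run s).nat ranks c =
      if N.bases.count c T < N.bases.cap c then 1 else 0 := by
  refine (Block.nat_loopTo_eq_ite rfl (by decide)
    (fun c => if s.nat counts c ≤ N.bound c then 1 else 0) (fun i s' _ hi hf _ => ?_) c).trans ?_
  · have hcount := hf.nat counts rfl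
    have hbound := (h.frame hf).bound
    split_ifs with hcond
    · rw [Block.run_ite_pos (by simpa [Cond.Holds, NatExpr.eval, hi, hcount, hbound])]
      simp [NatExpr.eval, hi]
    · rw [Block.run_ite_neg (by simpa [Cond.Holds, NatExpr.eval, hi, hcount, hbound] using hcond)]
      simp [NatExpr.eval, hi]
  · simp [h.m, hc, hcounts c hc, Net.bases]

theorem findExits_spec (h : N.Loaded s)
    (hd : N.bases.IsDual (s.real penalties) (N.marked (s.nat marks))) :
    (findExits.run s).nat marks = s.nat marks ∧
      N.HoldsCounts (N.marked (s.nat marks)) (findExits.run s) ∧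
      N.HoldsSearch (N.marked (s.nat marks)) (findExits.run s) N.m := by
  have hcounts := holdsCounts_countColors h
  have hL := h.run countColors
  have hf := countColors.frame_run s
  rw [← hf.nat marks rfl] at hcounts hd ⊢
  rw [← hf.real penalties rfl] at hd
  rw [findExits, Block.run_seq, Block.run_seq]
  generalize countColors.run s = s₁ at *
  have hranks (c : ℕ) (hc : c < N.m) := initSearch_spec hL hcounts hc
  have hf₁ := initSearch.frame_run s₁
  rw [← hf₁.nat marks rfl] at hcounts hranks hd ⊢
  rw [← hf₁.real penalties rfl] at hd
  obtain ⟨hmarks, hsearch⟩ := search_spec (hL.run initSearch)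
    (.init hd fun c hc => hranks c (Finset.mem_range.1 hc))
  refine ⟨hmarks, fun c hc => ?_, hsearch⟩
  rw [search.frame_run _ |>.nat counts rfl, hf₁.nat counts rfl, hcounts c hc]

/-- The colour `c` is used too often by `T` and has been reached, so that a path starts at it. -/
def Net.IsStart (N : Net) (T : Finset ℕ) (rank : ℕ → ℕ) (c : ℕ) : Prop :=
  c < N.m ∧ N.bases.cap c < N.bases.count c T ∧ 1 ≤ rank c

theorem Net.excess_eq_zero_iff :
    N.bases.excess T = 0 ↔ ∀ c < N.m, N.bases.count c T ≤ N.bases.cap c :=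
  ColoredBases.excess_eq_zero_iff.trans (forall_congr' fun _ => imp_congr_left Finset.mem_range)

theorem excess_eq_zero_or_forall_not_isFeasible (hs : N.HoldsSearch T s N.m)
    (hno : ∀ c, ¬ N.IsStart T (s.nat ranks) c) :
    N.bases.excess T = 0 ∨ ∀ T', ¬ N.bases.IsFeasible T' := by
  refine or_iff_not_imp_left.2 fun hexcess T' => ?_
  rw [Net.excess_eq_zero_iff] at hexcess
  push Not at hexcess
  obtain ⟨c, hc, hover⟩ := hexcess
  rw [Net.HoldsSearch, ← Finset.card_range N.m] at hs
  refine hs.not_isFeasible (Finset.mem_range.2 hc) hover ?_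
  by_contra h0
  exact hno c ⟨hc, hover, Nat.pos_of_ne_zero h0⟩

theorem chooseColor_spec (h : N.Loaded s) (hcounts : N.HoldsCounts T s) :
    (chooseColor.run s).nat chosenColor 0 = N.m ∧ (∀ c, ¬ N.IsStart T (s.nat ranks) c) ∨
      N.IsStart T (s.nat ranks) ((chooseColor.run s).nat chosenColor 0) := by
  have hL := h.run (.assign chosenColor (.get sizes (.lit 1)))
  have hf₁ := (Block.assign chosenColor (.get sizes (.lit 1))).frame_run s
  have hinit :
      ((Block.assign chosenColor (.get sizes (.lit 1))).run s).nat chosenColor 0 = N.m := by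
    simp [NatExpr.eval, h.m]
  rw [chooseColor, Block.run_seq]
  generalize (Block.assign chosenColor (.get sizes (.lit 1))).run s = s₁ at *
  have hloop := Block.loopTo_induction (s := s₁) (v := index) (k := 1) (d := 0)
    (p := .ite (.and isOver (.natLe (.lit 1) (.get ranks (.var index))))
      (.assign chosenColor (.var index)) .skip)
    (fun i s' => s'.nat chosenColor 0 = N.m ∧ (∀ c < i, ¬ N.IsStart T (s.nat ranks) c) ∨
      N.IsStart T (s.nat ranks) (s'.nat chosenColor 0))
    rfl (fun _ _ _ h => by simpa using h) (.inl ⟨hinit, by simp⟩) (fun i s' hi hc hf hI => ?_)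
  · rw [hL.m] at hloop
    exact hloop.imp_left fun ⟨hm, hno⟩ => ⟨hm, fun c hc => hno c hc.1 hc⟩
  · rw [hL.m, Nat.sub_zero] at hi
    have hover := isOver_holds_iff (T := T) (hL.frame hf)
      (by rwa [Net.HoldsCounts, hf.nat counts rfl, hf₁.nat counts rfl]) hi hc
    have hholds : (Cond.and isOver (.natLe (.lit 1) (.get ranks (.var index)))).Holds s' ↔
        N.IsStart T (s.nat ranks) i := by
      rw [Cond.Holds, hover, Net.IsStart, ← hf₁.nat ranks rfl, ← hf.nat ranks rfl]
      simp [Cond.Holds, NatExpr.eval, hc, hi]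
    by_cases hcond : N.IsStart T (s.nat ranks) i
    · rw [Block.run_ite_pos (hholds.2 hcond)]
      exact .inr (by simpa [hc] using hcond)
    · rw [Block.run_ite_neg (mt hholds.1 hcond), Block.run_skip, Nat.forall_lt_succ_right]
      exact hI.imp_left fun ⟨hm, hno⟩ => ⟨hm, hno, hcond⟩

theorem useExit_spec (h : N.Loaded s) (hs : N.HoldsSearch T s N.m) {c₀ : ℕ}
    (hw : N.bases.Walk T (s.real penalties) (s.nat ranks) (s.nat outs) (s.nat inns) c₀
      (N.marked (s.nat marks)) (s.nat chosenColor 0))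
    (h2 : 2 ≤ s.nat ranks (s.nat chosenColor 0)) :
    N.bases.Walk T (s.real penalties) (s.nat ranks) (s.nat outs) (s.nat inns) c₀
        (N.marked ((useExit.run s).nat marks)) ((useExit.run s).nat chosenColor 0) ∧
      s.nat ranks ((useExit.run s).nat chosenColor 0) < s.nat ranks (s.nat chosenColor 0) := by
  have hexit := hs.isExit _ hw.mem_palette h2
  have hin : s.nat inns (s.nat chosenColor 0) < N.m :=
    Finset.mem_range.1 hexit.exchange.mem_ground
  have hmarks : N.marked ((useExit.run s).nat marks) =
      insert (s.nat inns (s.nat chosenColor 0))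
        ((N.marked (s.nat marks)).erase (s.nat outs (s.nat chosenColor 0))) := by
    rw [← Net.marked_update_zero, ← Net.marked_update_one hin]
    simp [useExit, NatExpr.eval]
  have hcolor : (useExit.run s).nat chosenColor 0 =
      N.bases.color (s.nat inns (s.nat chosenColor 0)) := by
    simp [useExit, NatExpr.eval, h.color, Net.bases]
  rw [hmarks, hcolor]
  exact ⟨hw.step hs h2, hexit.lt⟩

theorem followExits_spec (h : N.Loaded s) (hs : N.HoldsSearch (N.marked (s.nat marks)) s N.m)
    (hstart : N.IsStart (N.marked (s.nat marks)) (s.nat ranks) (s.nat chosenColor 0)) :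
    ∃ c, s.nat ranks c = 1 ∧ N.bases.Walk (N.marked (s.nat marks)) (s.real penalties)
      (s.nat ranks) (s.nat outs) (s.nat inns) (s.nat chosenColor 0)
      (N.marked ((followExits.run s).nat marks)) c := by
  have hmem : s.nat chosenColor 0 ∈ N.bases.palette := Finset.mem_range.2 hstart.1
  have hloop := Block.loopTo_induction (s := s) (v := index) (k := 1) (d := 0)
    (p := .ite (.natLe (.lit 2) (.get ranks (.var chosenColor))) useExit .skip)
    (fun i s' => N.bases.Walk (N.marked (s.nat marks)) (s.real penalties) (s.nat ranks)
      (s.nat outs) (s.nat inns) (s.nat chosenColor 0) (N.marked (s'.nat marks))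
      (s'.nat chosenColor 0) ∧ (s.nat ranks (s'.nat chosenColor 0) = 1 ∨
        s.nat ranks (s'.nat chosenColor 0) + i ≤ N.m + 1))
    rfl (fun _ _ _ h => by simpa using h) ⟨hs.walk hmem hstart.2.2, .inr (hs.rank_le _ hmem)⟩
    (fun i s' hi hc hf ⟨hw, hle⟩ => ?_)
  · rw [h.m] at hloop
    have hpos := hloop.1.pos
    exact ⟨_, by have := hloop.2; lia, hloop.1⟩
  · have hpos := hw.pos
    by_cases hcond : 2 ≤ s.nat ranks (s'.nat chosenColor 0)
    · rw [Net.HoldsSearch] at hs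
      rw [← hf.nat ranks rfl, ← hf.nat outs rfl, ← hf.nat inns rfl, ← hf.real penalties rfl] at *
      rw [Block.run_ite_pos (by simpa [Cond.Holds, NatExpr.eval])]
      obtain ⟨hwalk, hlt⟩ := useExit_spec (h.frame hf) hs hw hcond
      exact ⟨hwalk, .inr (by lia)⟩
    · rw [Block.run_ite_neg (by simpa [Cond.Holds, NatExpr.eval, hf.nat ranks rfl] using hcond)]
      exact ⟨hw, .inl (by rw [Block.run_skip]; lia)⟩

theorem improve_spec (h : N.Loaded s)
    (hd : N.bases.IsDual (s.real penalties) (N.marked (s.nat marks))) :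
    N.bases.IsDual ((improve.run s).real penalties) (N.marked ((improve.run s).nat marks)) ∧
      (N.bases.excess (N.marked ((improve.run s).nat marks)) <
          N.bases.excess (N.marked (s.nat marks)) ∨
        N.bases.excess (N.marked ((improve.run s).nat marks)) = 0 ∨
        ∀ T, ¬ N.bases.IsFeasible T) := by
  obtain ⟨hmarks, hcounts, hs⟩ := findExits_spec h hd
  have hL := h.run findExits
  rw [← hmarks] at hcounts hs ⊢
  rw [improve, Block.run_seq, Block.run_seq]
  generalize findExits.run s = s₁ at *
  have hchoose := chooseColor_spec hL hcounts
  have hf := chooseColor.frame_run s₁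
  have hL₁ := hL.run chooseColor
  rw [Net.HoldsSearch] at hs
  rw [← hf.nat ranks rfl, ← hf.nat outs rfl, ← hf.nat inns rfl, ← hf.nat marks rfl,
    ← hf.real penalties rfl] at *
  generalize chooseColor.run s₁ = s₂ at *
  rcases hchoose with ⟨hm, hno⟩ | hstart
  · rw [Block.run_ite_pos (by simpa [NatExpr.eval, hL₁.m]), Block.run_skip]
    exact ⟨hs.isDual, .inr (excess_eq_zero_or_forall_not_isFeasible hs hno)⟩
  · rw [Block.run_ite_neg (by simpa [NatExpr.eval, hL₁.m] using hstart.1.ne)]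
    obtain ⟨c, hc, hw⟩ := followExits_spec hL₁ hs hstart
    have hdual := hw.isDual_and_excess_lt hs (Finset.mem_range.2 hstart.1) hstart.2.1 hc
    rw [followExits.frame_run s₂ |>.real penalties rfl]
    exact ⟨hdual.1, .inl hdual.2⟩

theorem improveAll_spec (h : N.Loaded s)
    (hd : N.bases.IsDual (s.real penalties) (N.marked (s.nat marks))) :
    N.bases.IsDual ((improveAll.run s).real penalties)
        (N.marked ((improveAll.run s).nat marks)) ∧
      (N.bases.excess (N.marked ((improveAll.run s).nat marks)) = 0 ∨
        ∀ T, ¬ N.bases.IsFeasible T) := by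
  have hle : N.bases.excess (N.marked (s.nat marks)) ≤ N.n := by
    have hcard := hd.isMinBase.1.card_add_one
    rw [Finset.card_range] at hcard
    exact (ColoredBases.excess_le_card hd.isMinBase.1).trans (by lia)
  have hloop := Block.loopTo_induction (s := s) (v := improveRound) (k := 0) (d := 0)
    (p := improve) (fun i s' =>
      N.bases.IsDual (s'.real penalties) (N.marked (s'.nat marks)) ∧
      (N.bases.excess (N.marked (s'.nat marks)) + i ≤ N.n ∨
        N.bases.excess (N.marked (s'.nat marks)) = 0 ∨ ∀ T, ¬ N.bases.IsFeasible T))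
    rfl (fun _ _ _ h => by simpa using h) ⟨hd, .inl hle⟩ (fun i s' _ _ hf ⟨hI, hle⟩ => ?_)
  · rw [h.n] at hloop
    exact ⟨hloop.1, hloop.2.elim (fun hle => .inl (by rw [improveAll]; lia)) id⟩
  · obtain ⟨hdual, hexcess⟩ := improve_spec (h.frame hf) hI
    refine ⟨hdual, ?_⟩
    rcases hexcess with hlt | hdone
    · exact hle.imp (by lia) (Or.imp_left (by lia))
    · exact .inr hdone

theorem verdict_spec (h : N.Loaded s) : (verdict.run s).nat answer 0 =
    if N.bases.excess (N.marked (s.nat marks)) = 0 then 1 else 0 := by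
  have hcounts := holdsCounts_countColors h
  have hL := (h.run countColors).run (.assign answer (.lit 1))
  rw [verdict, Block.run_seq, Block.run_seq]
  generalize countColors.run s = s₁ at *
  have hloop := Block.loopTo_induction (s := (Block.assign answer (.lit 1)).run s₁) (v := index)
    (k := 1) (d := 0) (p := .ite isOver (.assign answer (.lit 0)) .skip)
    (fun i s' => s'.nat answer 0 = if ∀ c < i,
      N.bases.count c (N.marked (s.nat marks)) ≤ N.bases.cap c then 1 else 0)
    rfl (fun _ _ _ h => by simpa using h) (by simp [NatExpr.eval]) (fun i s' hi hc hf hI => ?_)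
  · rw [hL.m, Nat.sub_zero] at hloop
    simpa only [Net.excess_eq_zero_iff] using hloop
  · rw [hL.m, Nat.sub_zero] at hi
    have hover := isOver_holds_iff (T := N.marked (s.nat marks)) (hL.frame hf)
      (by rw [Net.HoldsCounts, hf.nat counts rfl]; simpa [Net.HoldsCounts] using hcounts) hi hc
    by_cases hcond : isOver.Holds s'
    · rw [Block.run_ite_pos hcond]
      simpa [NatExpr.eval] using ⟨i, le_rfl, hover.1 hcond⟩
    · rw [Block.run_ite_neg hcond, Block.run_skip, hI]
      simp only [Nat.forall_lt_succ_right, not_lt.1 (mt hover.2 hcond), and_true]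

theorem improveAll_verdict_spec (h : N.Loaded s)
    (hd : N.bases.IsDual (s.real penalties) (N.marked (s.nat marks))) :
    ((improveAll.seq verdict).run s).nat answer 0 = 1 ∧ MinWeight N.bases.IsFeasible N.weight
        (N.marked (((improveAll.seq verdict).run s).nat marks)) ∨
      ((improveAll.seq verdict).run s).nat answer 0 = 0 ∧ ∀ T, ¬ N.bases.IsFeasible T := by
  obtain ⟨hdual, hexcess⟩ := improveAll_spec h hd
  rw [Block.run_seq, verdict_spec (h.run improveAll), verdict.frame_run _ |>.nat marks rfl]
  split_ifs with h0
  · have hfeas : N.bases.IsFeasible (N.marked ((improveAll.run s).nat marks)) :=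
      ⟨hdual.isMinBase.1, ColoredBases.excess_eq_zero_iff.1 h0⟩
    exact .inl ⟨rfl, hfeas, fun T hT => hdual.weight_le hfeas hT⟩
  · exact .inr ⟨rfl, hexcess.resolve_left h0⟩

theorem solveNet_spec (h : N.Loaded s) (hmarks : N.marked (s.nat marks) = ∅)
    (hanswer : s.nat answer 0 = 0) (hpen : s.real penalties = 0) :
    (solveNet.run s).nat answer 0 = 1 ∧
        MinWeight N.bases.IsFeasible N.weight (N.marked ((solveNet.run s).nat marks)) ∨
      (solveNet.run s).nat answer 0 = 0 ∧ ∀ T, ¬ N.bases.IsFeasible T := by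
  have hgreedy := isGreedy_greedy h hmarks
  have hL := h.run greedy
  have hf := greedy.frame_run s
  rw [← congrFun (hf.nat answer rfl) 0] at hanswer
  rw [← hf.real penalties rfl] at hpen
  rw [solveNet, Block.run_seq, Block.run_seq]
  generalize greedy.run s = s₁ at *
  have htest := testConnected_spec hL
  have hL₁ := hL.run testConnected
  have hf₁ := testConnected.frame_run s₁
  rw [← hf₁.nat marks rfl] at hgreedy htest
  rw [← congrFun (hf₁.nat answer rfl) 0] at hanswer
  rw [← hf₁.real penalties rfl] at hpen
  generalize testConnected.run s₁ = s₂ at *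
  have hholds : (Cond.and (.natLe (.lit 1) (.get sizes (.lit 0)))
      (.natEq (.var connected) (.lit 1))).Holds s₂ ↔
        0 < N.n ∧ s₂.nat connected 0 = 1 := by
    simp [Cond.Holds, NatExpr.eval, hL₁.n, Nat.succ_le_iff]
  by_cases hcond : 0 < N.n ∧ s₂.nat connected 0 = 1
  · rw [Block.run_ite_pos (hholds.2 hcond)]
    have hbase := (hgreedy.isBase_iff hcond.1 Net.marked_subset).2 ((htest hcond.1).1 hcond.2)
    exact improveAll_verdict_spec hL₁ (hpen ▸ ColoredBases.isDual_zero (hgreedy.minWeight hbase))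
  · rw [Block.run_ite_neg (mt hholds.1 hcond)]
    refine .inr ⟨hanswer, fun T hT => hcond ?_⟩
    have hcard := hT.1.card_add_one
    rw [Finset.card_range] at hcard
    have hn : 0 < N.n := by lia
    exact ⟨hn, (htest hn).2 ((hgreedy.isBase_iff hn Net.marked_subset).1
      (hgreedy.minWeight hT.1).1)⟩

end Solve

/-! ### Instances and nets -/

variable {V : Type*} {I : Inst V}

namespace Listing

open Classical in
/-- The positions in the list of the edges of `H`. -/
noncomputable def positions (L : Listing I) (H : SimpleGraph V) : Finset (Fin L.m) :=
  Finset.univ.filter fun j => L.edge j ∈ I.edgesOf H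

/-- The edges of `H` as a set of edges of a net. -/
noncomputable def codes (L : Listing I) (H : SimpleGraph V) : Finset ℕ :=
  (L.positions H).map Fin.valEmbedding

/-- The subgraph with the edges whose positions belong to `T`. -/
def subgraph (L : Listing I) (T : Finset ℕ) : SimpleGraph V :=
  SimpleGraph.fromEdgeSet {e : Sym2 V | ∃ j : Fin L.m, (j : ℕ) ∈ T ∧ e = L.edge j}

variable {L : Listing I} {H : SimpleGraph V}

theorem mem_positions {j : Fin L.m} : j ∈ L.positions H ↔ L.edge j ∈ I.edgesOf H := by
  simp [positions]

theorem mem_codes {j : Fin L.m} : (j : ℕ) ∈ L.codes H ↔ L.edge j ∈ I.edgesOf H :=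
  (Finset.mem_map' Fin.valEmbedding).trans mem_positions

theorem exists_of_mem_codes {j : ℕ} (h : j ∈ L.codes H) :
    ∃ i : Fin L.m, (i : ℕ) = j ∧ L.edge i ∈ I.edgesOf H := by
  obtain ⟨i, hi, rfl⟩ := Finset.mem_map.1 h
  exact ⟨i, rfl, mem_positions.1 hi⟩

theorem edgesOf_eq_image : I.edgesOf H = L.edge '' (L.positions H : Set (Fin L.m)) := by
  ext e
  obtain ⟨j, rfl⟩ := L.edge.surjective e
  simp [mem_positions]

theorem card_codes (h : H ≤ I.G) : (L.codes H).card = Nat.card H.edgeSet := by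
  have himage : Subtype.val '' I.edgesOf H = H.edgeSet :=
    Subtype.image_preimage_coe _ _ |>.trans
      (Set.inter_eq_right.2 (SimpleGraph.edgeSet_mono h))
  rw [Nat.card_coe_set_eq, ← himage, Set.ncard_image_of_injective _ Subtype.val_injective,
    edgesOf_eq_image (L := L), Set.ncard_image_of_injective _ L.edge.injective,
    Set.ncard_coe_finset, codes, Finset.card_map]

theorem edgeSet_subgraph (T : Finset ℕ) :
    (L.subgraph T).edgeSet = {e : Sym2 V | ∃ j : Fin L.m, (j : ℕ) ∈ T ∧ e = L.edge j} := by
  rw [subgraph, SimpleGraph.edgeSet_fromEdgeSet]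
  refine sdiff_eq_left.2 (Set.disjoint_left.2 ?_)
  rintro e ⟨j, -, rfl⟩
  exact I.G.not_isDiag_of_mem_edgeSet (L.edge j).2

theorem subgraph_le (T : Finset ℕ) : L.subgraph T ≤ I.G := by
  rw [← SimpleGraph.edgeSet_subset_edgeSet, edgeSet_subgraph]
  rintro e ⟨j, -, rfl⟩
  exact (L.edge j).2

theorem edge_mem_edgesOf_subgraph {T : Finset ℕ} {j : Fin L.m} :
    L.edge j ∈ I.edgesOf (L.subgraph T) ↔ (j : ℕ) ∈ T := by
  rw [Inst.edgesOf, Set.mem_ofPred_eq, edgeSet_subgraph]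
  refine ⟨fun ⟨i, hi, h⟩ => ?_, fun h => ⟨j, h, rfl⟩⟩
  rwa [L.edge.injective (Subtype.val_injective h)]

theorem codes_subgraph {T : Finset ℕ} (hT : ∀ j ∈ T, j < L.m) : L.codes (L.subgraph T) = T := by
  ext j
  refine ⟨fun h => ?_, fun h => ?_⟩
  · obtain ⟨i, rfl, hi⟩ := exists_of_mem_codes h
    exact edge_mem_edgesOf_subgraph.1 hi
  · exact mem_codes (j := ⟨j, hT j h⟩).2 (edge_mem_edgesOf_subgraph.2 h)

/-- The net `N` has the vertices, edges, upper bounds and weights of the instance, its colours are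
the classes of a digraph `D` of disjoint complete digraphs, and there are no lower bounds. -/
structure Represents (L : Listing I) (N : Net) : Prop where
  n : N.n = L.n
  m : N.m = L.m
  x : ∀ j : Fin L.m, N.x j = L.end₁ j
  y : ∀ j : Fin L.m, N.y j = L.end₂ j
  weight : ∀ j : Fin L.m, N.weight j = I.w (L.edge j)
  bound : ∀ j : Fin L.m, N.bound (N.color j) = I.up (L.edge j)
  color : ∀ i j : Fin L.m, N.color i = N.color j ↔ i = j ∨ I.D.Adj (L.edge i) (L.edge j)
  lo : ∀ e, I.lo e = 0
  loopless : ∀ e, ¬ I.D.Adj e e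

namespace Represents

variable {N : Net}

theorem linked_of_adj (hN : L.Represents N) (h : H ≤ I.G) {a b : V} (hab : H.Adj a b) :
    Linked N.x N.y (L.codes H) (L.vertex.symm a) (L.vertex.symm b) := by
  have hmem : s(a, b) ∈ H.edgeSet := hab
  obtain ⟨j, hj⟩ := L.edge.surjective ⟨s(a, b), SimpleGraph.edgeSet_mono h hmem⟩
  have hlinked : Linked N.x N.y (L.codes H) (N.x j) (N.y j) :=
    .of_mem (mem_codes.2 (by rwa [hj]))
  have hedge := L.edge_eq j
  rw [hN.x, hN.y] at hlinked
  rw [hj, Sym2.eq_iff] at hedge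
  rcases hedge with ⟨rfl, rfl⟩ | ⟨rfl, rfl⟩
  · simpa using hlinked
  · simpa using hlinked.symm

theorem linked_of_reachable (hN : L.Represents N) (h : H ≤ I.G) {a b : V}
    (hab : H.Reachable a b) :
    Linked N.x N.y (L.codes H) (L.vertex.symm a) (L.vertex.symm b) := by
  obtain ⟨p⟩ := hab
  induction p with
  | nil => exact .refl _
  | cons hadj _ ih => exact (hN.linked_of_adj h hadj).trans ih

theorem reachable_of_linked (hN : L.Represents N) {u v : Fin L.n}
    (huv : Linked N.x N.y (L.codes H) u v) : H.Reachable (L.vertex u) (L.vertex v) := by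
  -- `r` extends reachability to all numbers so that it remains an equivalence relation.
  let r (u v : ℕ) : Prop := u = v ∨ ∃ i j : Fin L.n,
    (i : ℕ) = u ∧ (j : ℕ) = v ∧ H.Reachable (L.vertex i) (L.vertex j)
  have hr : Equivalence r := by
    refine ⟨fun _ => .inl rfl, ?_, ?_⟩
    · rintro u v (rfl | ⟨i, j, hi, hj, h⟩)
      exacts [.inl rfl, .inr ⟨j, i, hj, hi, h.symm⟩]
    · rintro u v p (rfl | ⟨i, j, hi, rfl, h⟩) (rfl | ⟨i', j', hi', hj', h'⟩)
      · exact .inl rfl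
      · exact .inr ⟨i', j', hi', hj', h'⟩
      · exact .inr ⟨i, j, hi, rfl, h⟩
      · rw [Fin.ext hi'] at h'
        exact .inr ⟨i, j', hi, hj', h.trans h'⟩
  have hedge : ∀ j ∈ L.codes H, r (N.x j) (N.y j) := by
    intro j hj
    obtain ⟨i, rfl, hi⟩ := exists_of_mem_codes hj
    rw [Inst.edgesOf, Set.mem_ofPred_eq, L.edge_eq] at hi
    exact .inr ⟨_, _, (hN.x i).symm, (hN.y i).symm, SimpleGraph.Adj.reachable hi⟩
  rcases huv.rec_equivalence hr hedge with h | ⟨i, j, hi, hj, h⟩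
  · rw [Fin.ext h]
  · rwa [Fin.ext hi, Fin.ext hj] at h

theorem isTree_iff_isBase [Finite V] (hN : L.Represents N) (h : H ≤ I.G) :
    H.IsTree ↔ N.bases.IsBase (L.codes H) := by
  have hV : Nat.card V = N.n := by rw [hN.n, ← Nat.card_congr L.vertex, Nat.card_fin]
  rw [SimpleGraph.isTree_iff_connected_and_card, hV, ← card_codes (L := L) h]
  constructor
  · rintro ⟨hconn, hcard⟩
    refine ⟨fun j hj => ?_, by rwa [Finset.card_range], fun u hu v hv => ?_⟩
    · obtain ⟨i, rfl, -⟩ := exists_of_mem_codes hj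
      simp [hN.m]
    · rw [Finset.mem_range, hN.n] at hu hv
      simpa using
        hN.linked_of_reachable h (hconn.preconnected (L.vertex ⟨u, hu⟩) (L.vertex ⟨v, hv⟩))
  · intro hT
    have hcard : (L.codes H).card + 1 = N.n := by simpa using hT.card_add_one
    have : Nonempty V := ⟨L.vertex ⟨0, by rw [← hN.n]; lia⟩⟩
    refine ⟨⟨fun a b => ?_⟩, hcard⟩
    obtain ⟨u, rfl⟩ := L.vertex.surjective a
    obtain ⟨v, rfl⟩ := L.vertex.surjective b
    exact hN.reachable_of_linked (hT.linked u (by simp [hN.n]) v (by simp [hN.n]))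

theorem weight_eq_sum (hN : L.Represents N) : I.weight H = ∑ j ∈ L.codes H, N.weight j := by
  rw [Inst.weight, edgesOf_eq_image (L := L), finsum_mem_image L.edge.injective.injOn,
    finsum_mem_coe_finset, codes, Finset.sum_map]
  exact Finset.sum_congr rfl fun j _ => (hN.weight j).symm

/-- The dependency set of an edge is its colour class without the edge itself. -/
theorem ncard_dep_add_one (hN : L.Represents N) {j : Fin L.m} (hj : L.edge j ∈ I.edgesOf H) :
    (I.dep (L.edge j) ∩ I.edgesOf H).ncard + 1 = N.bases.count (N.color j) (L.codes H) := by
  classical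
  let sameColor := (L.positions H).filter fun i : Fin L.m => N.color i = N.color j
  have hdep : I.dep (L.edge j) ∩ I.edgesOf H = L.edge '' (sameColor.erase j :) := by
    ext e
    obtain ⟨i, rfl⟩ := L.edge.surjective e
    have hloop : L.edge i ∈ I.dep (L.edge j) → i ≠ j := by
      rintro ha rfl
      exact hN.loopless _ ha
    simp only [Set.mem_inter_iff, Set.mem_image, EmbeddingLike.apply_eq_iff_eq, exists_eq_right,
      Finset.mem_coe, sameColor, Finset.mem_erase, Finset.mem_filter, mem_positions, hN.color]
    change _ ↔ _ ∧ _ ∧ (_ ∨ L.edge i ∈ I.dep (L.edge j))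
    tauto
  rw [hdep, Set.ncard_image_of_injective _ L.edge.injective, Set.ncard_coe_finset,
    Finset.card_erase_add_one (by simp [sameColor, mem_positions, hj]), ColoredBases.count, codes,
    Finset.filter_map, Finset.card_map]
  rfl

theorem satisfies_iff (hN : L.Represents N) :
    I.Satisfies H ↔ ∀ c < N.m, N.bases.count c (L.codes H) ≤ N.bound c + 1 := by
  constructor
  · intro h c _
    rcases Nat.eq_zero_or_pos (N.bases.count c (L.codes H)) with h0 | hpos
    · exact h0 ▸ Nat.zero_le _
    · obtain ⟨i, hi⟩ := Finset.card_pos.1 hpos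
      obtain ⟨hcodes, rfl⟩ := Finset.mem_filter.1 hi
      obtain ⟨j, rfl, hj⟩ := exists_of_mem_codes hcodes
      change N.bases.count (N.color j) _ ≤ N.bound (N.color j) + 1
      rw [hN.bound, ← hN.ncard_dep_add_one hj]
      exact Nat.succ_le_succ (h _ hj).2
  · intro h e he
    obtain ⟨j, rfl⟩ := L.edge.surjective e
    have hcount := h (N.color j) (N.color_lt j (by simp [hN.m]))
    rw [hN.bound, ← hN.ncard_dep_add_one he] at hcount
    exact ⟨hN.lo _ ▸ Nat.zero_le _, Nat.le_of_succ_le_succ hcount⟩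

theorem isFeasible_iff [Finite V] (hN : L.Represents N) (h : H ≤ I.G) :
    I.IsFeasible H ↔ N.bases.IsFeasible (L.codes H) := by
  rw [Inst.IsFeasible, hN.isTree_iff_isBase h, hN.satisfies_iff, and_iff_right h,
    ColoredBases.IsFeasible]
  simp [Net.bases]

theorem correctOutput [Finite V] (hN : L.Represents N) {s : Mem}
    (hs : s.nat answer 0 = 1 ∧ MinWeight N.bases.IsFeasible N.weight (N.marked (s.nat marks)) ∨
      s.nat answer 0 = 0 ∧ ∀ T, ¬ N.bases.IsFeasible T) : L.CorrectOutput s := by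
  rcases hs with ⟨hanswer, hfeas, hmin⟩ | ⟨hanswer, hno⟩
  · set T := N.marked (s.nat marks) with hT
    have hle := subgraph_le (L := L) T
    have hcodes : L.codes (L.subgraph T) = T :=
      codes_subgraph fun j hj => hN.m ▸ (Net.mem_marked.1 hj).1
    refine .inl ⟨hanswer, L.subgraph T, ⟨?_, fun T' hT' => ?_⟩, fun j => ?_⟩
    · rwa [hN.isFeasible_iff hle, hcodes]
    · rw [hN.weight_eq_sum, hN.weight_eq_sum, hcodes]
      exact hmin _ ((hN.isFeasible_iff hT'.1).1 hT')
    · rw [edge_mem_edgesOf_subgraph, hT, Net.mem_marked, hN.m]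
      simp
  · exact .inr ⟨hanswer, fun T hT => hno _ ((hN.isFeasible_iff hT.1).1 hT)⟩

end Represents

end Listing

/-! ### The whole program -/

/-- Replaces the colour of the head of the arc `index` by the tail, if the tail is smaller. -/
def lowerColor : Block :=
  .ite (.natLe (.get colors (.get heads (.var index))) (.get tails (.var index))) .skip
    (.setNat colors (.get heads (.var index)) (.get tails (.var index)))

/-- Colours each edge by the least edge that equals it or has an arc to it. -/
def assignColors : Block :=
  .seq (forEdges index (.setNat colors (.var index) (.var index))) <|
  forArcs index lowerColor

/-- The program for the whole problem. -/
def solve : Block := assignColors.seq solveNet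

theorem lowerColor_spec (s : Mem) (j : ℕ) : (lowerColor.run s).nat colors j =
    if s.nat heads (s.nat index 0) = j then min (s.nat tails (s.nat index 0)) (s.nat colors j)
    else s.nat colors j := by
  by_cases hcond : s.nat colors (s.nat heads (s.nat index 0)) ≤ s.nat tails (s.nat index 0)
  · rw [lowerColor, Block.run_ite_pos (by simpa [Cond.Holds, NatExpr.eval] using hcond),
      Block.run_skip]
    split_ifs with hj
    · rw [← hj, min_eq_right hcond]
    · rfl
  · rw [lowerColor, Block.run_ite_neg (by simpa [Cond.Holds, NatExpr.eval] using hcond)]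
    rcases eq_or_ne (s.nat heads (s.nat index 0)) j with rfl | hj
    · simp [NatExpr.eval, (not_le.1 hcond).le]
    · simp [NatExpr.eval, hj, hj.symm]

theorem assignColors_spec (s : Mem) {j : ℕ} (hj : j < s.nat sizes 1) :
    IsLeast (insert j (((Finset.range (s.nat sizes 2)).filter fun q => s.nat heads q = j).image
      (s.nat tails)) : Finset ℕ) ((assignColors.run s).nat colors j) := by
  let initColors := forEdges index (.setNat colors (.var index) (.var index))
  have hinit : (initColors.run s).nat colors j = j :=
    (Block.nat_loopTo_eq_ite rfl (by decide) id (fun i s' _ hc _ _ => by simp [hc]) j).trans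
      (if_pos hj)
  have hf := initColors.frame_run s
  rw [assignColors, Block.run_seq]
  change IsLeast _ (((forArcs index lowerColor).run (initColors.run s)).nat colors j)
  generalize initColors.run s = s₁ at hinit hf ⊢
  rw [← hf.nat sizes rfl, ← hf.nat tails rfl, ← hf.nat heads rfl]
  refine Block.loopTo_induction (s := s₁) (v := index) (d := 0) (p := lowerColor) (fun i s' =>
      IsLeast (insert j (((Finset.range i).filter fun q => s₁.nat heads q = j).image
        (s₁.nat tails)) : Finset ℕ) (s'.nat colors j))
    rfl (fun _ _ _ h => by simpa using h) (by simp [hinit]) fun i s' _ hc hf' hI => ?_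
  rw [lowerColor_spec, hc, hf'.nat tails rfl, hf'.nat heads rfl, Finset.range_add_one,
    Finset.filter_insert]
  split_ifs
  · rw [Finset.image_insert, Finset.insert_comm, Finset.coe_insert]
    exact hI.insert _
  · exact hI

theorem array_apply {α : Type*} [Zero α] {k : ℕ} (f : Fin k → α) (i : Fin k) :
    array f i = f i := by
  simp [array]

theorem IsDisjointUnionOfComplete.exists_setoid {E : Type*} {D : Digraph E} {k : ℕ}
    {C : Fin k → Set E} (hD : IsDisjointUnionOfComplete D C) :
    ∃ r : Setoid E, ∀ e f, D.Adj e f ↔ e ≠ f ∧ r e f := by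
  have hC : ∀ e, ∃! i, e ∈ C i := fun e => by
    obtain ⟨i, hi⟩ := Set.mem_iUnion.1 (hD.cover ▸ Set.mem_univ e)
    refine ⟨i, hi, fun j hj => ?_⟩
    by_contra hij
    exact Set.disjoint_left.1 (hD.disjoint j i hij) hj hi
  choose c hc huniq using hC
  refine ⟨Setoid.ker c, fun e f => ?_⟩
  rw [hD.adj_iff, Setoid.ker_def]
  refine and_congr_right fun _ => ⟨fun ⟨i, he, hf⟩ => ?_, fun h => ⟨c e, hc e, h ▸ hc f⟩⟩
  exact (huniq e i he).symm.trans (huniq f i hf)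

namespace Listing

variable (L : Listing I)

theorem nat_input_zero_le (k : ℕ) : L.input.nat 0 k ≤ L.size := by
  change array ![L.n, L.m, L.a] k ≤ L.size
  rw [array, size]
  split_ifs with h
  · interval_cases k <;> simp <;> lia
  · exact Nat.zero_le _

variable {r : Setoid I.G.edgeSet} (hr : ∀ e f, I.D.Adj e f ↔ e ≠ f ∧ r e f)

include hr in
theorem isLeast_assignColors (j : Fin L.m) :
    IsLeast (Fin.val '' {i | r (L.edge i) (L.edge j)})
      ((assignColors.run L.input).nat colors j) := by
  have htails (q : Fin L.a) : L.input.nat tails q = L.tail q :=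
    array_apply (fun q => (L.tail q : ℕ)) q
  have hheads (q : Fin L.a) : L.input.nat heads q = L.head q :=
    array_apply (fun q => (L.head q : ℕ)) q
  convert assignColors_spec L.input (j := j) j.2 using 1
  ext t
  simp only [Finset.coe_insert, Finset.coe_image, Finset.coe_filter, Finset.mem_range]
  constructor
  · rintro ⟨i, hi, rfl⟩
    rcases eq_or_ne i j with rfl | hij
    · exact .inl rfl
    · obtain ⟨q, hq, hq'⟩ := (L.arc_iff _ _).1 ((hr _ _).2 ⟨L.edge.injective.ne hij, hi⟩)
      refine .inr ⟨q, ⟨q.2, ?_⟩, ?_⟩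
      · rw [hheads, L.edge.injective hq']
      · rw [htails, L.edge.injective hq]
  · rintro (rfl | ⟨q, ⟨hq, hhead⟩, rfl⟩)
    · exact ⟨j, r.refl _, rfl⟩
    · rw [hheads ⟨q, hq⟩] at hhead
      refine ⟨L.tail ⟨q, hq⟩, ?_, (htails ⟨q, hq⟩).symm⟩
      rw [← Fin.ext hhead]
      exact ((hr _ _).1 ((L.arc_iff _ _).2 ⟨⟨q, hq⟩, rfl, rfl⟩)).2

/-- The net of an instance, with the computed colours. -/
noncomputable def net : Net where
  n := L.n
  m := L.m
  x := array fun j => (L.end₁ j : ℕ)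
  y := array fun j => (L.end₂ j : ℕ)
  bound := array fun j => I.up (L.edge j)
  color := (assignColors.run L.input).nat colors
  weight := array fun j => I.w (L.edge j)
  x_lt j hj := by
    rw [array, dif_pos hj]
    exact Fin.is_lt _
  y_lt j hj := by
    rw [array, dif_pos hj]
    exact Fin.is_lt _
  color_lt _ hj :=
    ((assignColors_spec L.input hj).2 (Finset.mem_insert_self _ _)).trans_lt hj

include hr in
theorem represents_net (hlo : ∀ e, I.lo e = 0) (hup : ∀ e f, I.D.Adj e f → I.up e = I.up f) :
    L.Represents L.net where
  n := rfl
  m := rfl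
  x := array_apply fun j => (L.end₁ j : ℕ)
  y := array_apply fun j => (L.end₂ j : ℕ)
  weight := array_apply fun j => I.w (L.edge j)
  bound j := by
    obtain ⟨i, hij, hi⟩ := (L.isLeast_assignColors hr j).1
    change array (fun j => I.up (L.edge j)) ((assignColors.run L.input).nat colors j) = _
    rw [← hi, array_apply]
    rcases eq_or_ne (L.edge i) (L.edge j) with h | h
    · rw [h]
    · exact hup _ _ ((hr _ _).2 ⟨h, hij⟩)
  color i j := by
    have hclass : (assignColors.run L.input).nat colors i = (assignColors.run L.input).nat colors j
        ↔ r (L.edge i) (L.edge j) := by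
      have hi := L.isLeast_assignColors hr i
      have hj := L.isLeast_assignColors hr j
      refine ⟨fun h => ?_, fun h => ?_⟩
      · obtain ⟨c, hci, hc⟩ := hi.1
        obtain ⟨d, hdj, hd⟩ := hj.1
        rw [← hc, ← hd] at h
        rw [Fin.ext h] at hci
        exact r.trans (r.symm hci) hdj
      · have hset : {c | r (L.edge c) (L.edge i)} = {c | r (L.edge c) (L.edge j)} :=
          Set.ext fun c => ⟨fun hc => r.trans hc h, fun hc => r.trans hc (r.symm h)⟩
        exact (hset ▸ hi).unique hj
    refine hclass.trans ?_
    rw [hr, L.edge.injective.ne_iff]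
    refine ⟨fun h => or_iff_not_imp_left.2 fun hij => ⟨hij, h⟩, ?_⟩
    rintro (rfl | h)
    exacts [r.refl _, h.2]
  lo := hlo
  loopless e := by simp [hr]

theorem loaded_net : L.net.Loaded (assignColors.run L.input) where
  n := congrFun (assignColors.frame_run L.input |>.nat sizes rfl) 0
  m := congrFun (assignColors.frame_run L.input |>.nat sizes rfl) 1
  x := assignColors.frame_run L.input |>.nat ends₁ rfl
  y := assignColors.frame_run L.input |>.nat ends₂ rfl
  bound := assignColors.frame_run L.input |>.nat bounds rfl
  color := rfl
  weight := assignColors.frame_run L.input |>.real weights rfl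

include hr in
theorem correctOutput_solve [Finite V] (hlo : ∀ e, I.lo e = 0)
    (hup : ∀ e f, I.D.Adj e f → I.up e = I.up f) : L.CorrectOutput (solve.run L.input) := by
  have hf := assignColors.frame_run L.input
  have hmarks : L.net.marked ((assignColors.run L.input).nat marks) = ∅ := by
    rw [hf.nat marks rfl]
    exact Finset.filter_false_of_mem fun _ _ => zero_ne_one
  exact (L.represents_net hr hlo hup).correctOutput
    (solveNet_spec L.loaded_net hmarks (congrFun (hf.nat answer rfl) 0) (hf.real penalties rfl))

end Listing

end GDC

/-- The generalized dependency constrained minimum spanning tree problem `(G, D, 0, u, w)` is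
solvable in polynomial time, by one program for all instances, when `D` is a disjoint union of
complete digraphs with vertex sets `C i` and `u = b i - 1` on `C i`, with `1 ≤ b i ≤ |C i|`. -/
theorem mainTheorem8 :
    ∃ (P : RealRAM.Program) (p : Polynomial ℕ),
      ∀ (V : Type*) [Finite V] (G : SimpleGraph V) (D : Digraph G.edgeSet)
        (u : G.edgeSet → ℕ) (w : G.edgeSet → ℝ)
        (k : ℕ) (C : Fin k → Set G.edgeSet) (b : Fin k → ℕ),
        GDC.IsDisjointUnionOfComplete D C →
        (∀ i, 1 ≤ b i ∧ b i ≤ (C i).ncard) →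
        (∀ i, ∀ e ∈ C i, u e = b i - 1) →
        GDC.SolvesWithin P p
          { G := G, D := D, lo := fun _ => 0, up := u, w := w } := by
  refine ⟨GDC.solve.compile, GDC.solve.time, ?_⟩
  intro V _ G D u w k C b hD _ hu L
  obtain ⟨t, ht, hrun⟩ :=
    RealRAM.Block.exists_runs (p := GDC.solve) rfl rfl L.nat_input_zero_le
  obtain ⟨r, hr⟩ := hD.exists_setoid
  refine ⟨t, _, hrun, ht, L.correctOutput_solve hr (fun _ => rfl) fun e f hef => ?_⟩
  obtain ⟨-, i, he, hf⟩ := (hD.adj_iff e f).1 hef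
  exact (hu i e he).trans (hu i f hf).symm
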